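/- **Setting.** Let $p\ge 2$ be real, let $A\in\mathbb R^{n\times d}$ have full column rank $d$ (so $n\ge d$), let $g\in\mathbb R^d$, and let $R\in\mathbb R_{\ge 0}^{n\times n}$ be diagonal. $(A,g,R)$ is an instance of the *scaled residual problem* if there is $x_\star\in\mathbb R^d$ with $g^\top x_\star=-1$, $x_\star^\top A^\top RAx_\star\le 1$ and $\|Ax_\star\|_p\le 1$. A vector $y$ is a *$\beta$-approximate solution* if $g^\top y=-1$, $y^\top A^\top RAy\le\beta$ and $\|Ay\|_p\le\beta$. Cost is measured by the number of *solves*, i.e. exact solutions of linear systems in matrices $A^\top DA$ with $D$ a nonnegative diagonal matrix. For a vector $s$, $S$ denotes $\mathrm{diag}(s)$, and powers and absolute values of vectors are entrywise. **Algorithm** $\textsc{Oracle}(A,g,R,p)$. 1. *Weights.* Start with $w^{(0)}_i=d/n$ for all $i$. For $k=0,\dots,T_0-1$, where $T_0=\lceil 10\log n\rceil$, let $w^{(k+1)}$ be the random-sign-sketch estimate, with accuracy parameter $\varepsilon=1/10$, of the leverage scores of $B=(W^{(k)})^{1/2-1/p}A$: draw, afresh in each round, $Q\in\mathbb R^{m\times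 n}$ with $m=\lceil c\,\varepsilon^{-2}\log n\rceil$ and independent uniform entries $\pm1/\sqrt m$, and set $w^{(k+1)}_i=\|QB(B^\top B)^{-1}b_i\|_2^2$, where $b_i$ is the $i$-th row of $B$; this takes $m$ solves. Let $w=\frac{3}{2T_0}\sum_{k=0}^{T_0-1}w^{(k)}$. 2. *Main loop.* Set $y=0$, $s=w^{1/p}$, $\kappa=p\,d^{1/p}$, $\alpha=\frac1{1000p}d^{-\frac{p^2-5p+2}{p(3p-2)}}$, $\tau=40^p d^{\frac{(p-2)(p-1)}{3p-2}}$, $T=\lfloor\alpha^{-1}d^{1/p}\rfloor$. Repeat $T$ times: - $z\leftarrow\arg\min_{g^\top x=-1}x^\top A^\top\big(d^{1-\frac2p}R+S^{p-2}\big)Ax$ (one solve); - while $\|Az\|_p^p\ge\tau$ (for $p=2$ this never happens): for all $i$ with $s_i\le 2^{-\frac p{p-2}}\kappa|(Az)_i|$ replace $s_i$ by $\Big(s_i^{p-2}+\frac{\tau^{2/p}|(Az)_i|^{p-2}}{4\|Az\|_p^p}\Big)^{\frac1{p-2}}$, and then recompute $z$ as above for the new $s$ (one solve); - $y\leftarrow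 y+\alpha z$ and $s\leftarrow s+\alpha|Az|$. Return $(\alpha T)^{-1}y$. **Lemma.** There is an absolute constant $K>0$, and for every $C>0$ there are constants $c>0$ (the sketch size constant in step 1) and $L>0$ depending only on $C$, such that for all $p\ge2$, all $n,d$ and every instance $(A,g,R)$ of the scaled residual problem with $A$ of full column rank, with probability at least $1-n^{-C}$: the algorithm $\textsc{Oracle}(A,g,R,p)$ terminates and returns a $(Kp)^p$-approximate solution, its main loop uses at most $(Kp)^p\,d^{\frac{p-2}{3p-2}}$ solves, and its weight computation uses at most $L(\log n)^2$ solves. -/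

import Mathlib

open Matrix

noncomputable section

namespace LpOracle

variable {n d : ℕ}

/-- The `ℓ_p` norm `(∑ |v_i|^p)^{1/p}`. -/
def lpNorm (p : ℝ) (v : Fin n → ℝ) : ℝ := (∑ i, |v i| ^ p) ^ (1 / p)

/-- `A, g, R = diag r` is an instance of the scaled residual problem. -/
def IsScaledResidual (A : Matrix (Fin n) (Fin d) ℝ) (g : Fin d → ℝ) (r : Fin n → ℝ) (p : ℝ) :
    Prop :=
  (∀ i, 0 ≤ r i) ∧ ∃ x : Fin d → ℝ, g ⬝ᵥ x = -1 ∧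
    x ⬝ᵥ ((Aᵀ * diagonal r * A) *ᵥ x) ≤ 1 ∧ lpNorm p (A *ᵥ x) ≤ 1

/-- `y` is a `β`-approximate solution of the scaled residual problem. -/
def IsApproxSolution (A : Matrix (Fin n) (Fin d) ℝ) (g : Fin d → ℝ) (r : Fin n → ℝ) (p β : ℝ)
    (y : Fin d → ℝ) : Prop :=
  g ⬝ᵥ y = -1 ∧ y ⬝ᵥ ((Aᵀ * diagonal r * A) *ᵥ y) ≤ β ∧ lpNorm p (A *ᵥ y) ≤ β

/-! ### The solver

A subroutine returns its value together with the number of linear systems in matrices `Aᵀ D A`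
that it has solved. Inverses are accessed only through `solve`. -/

/-- One exact solve of `(Aᵀ D A) x = b`, where `D` is the diagonal matrix of `D`. Cost: one. -/
def solve (A : Matrix (Fin n) (Fin d) ℝ) (D : Fin n → ℝ) (b : Fin d → ℝ) : (Fin d → ℝ) × ℕ :=
  ((Aᵀ * diagonal D * A)⁻¹ *ᵥ b, 1)

/-! ### Lewis weight overestimates -/

/-- A fair random sign. -/
def signOf (b : Bool) : ℝ := if b then 1 else -1

/-- `ApproxLev(V A, ε)` for the row scaling `V = diag v`: the random sign sketch estimate of the
leverage scores of `B = V A`. With `k = ⌈c ε⁻² log n⌉` and a `k × n` matrix `Q` of independent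
uniform signs over `√k`, it returns `i ↦ ‖Q B (Bᵀ B)⁻¹ b_i‖₂²`, where `b_i` is row `i` of `B`, by
means of `k` solves in `Bᵀ B = Aᵀ V² A`, one for each row of `Q B`. -/
def approxLev (c ε : ℝ) (A : Matrix (Fin n) (Fin d) ℝ) (v : Fin n → ℝ) :
    PMF ((Fin n → ℝ) × ℕ) :=
  let k : ℕ := ⌈c * ε⁻¹ ^ 2 * Real.log n⌉₊
  (PMF.uniformOfFintype (Fin k → Fin n → Bool)).map fun ω =>
    let Q : Fin k → Fin n → ℝ := fun j i => signOf (ω j i) / √k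
    let B : Matrix (Fin n) (Fin d) ℝ := diagonal v * A
    let u : Fin k → (Fin d → ℝ) × ℕ := fun j => solve A (fun i => v i ^ 2) (Bᵀ *ᵥ Q j)
    (fun i => ∑ j, ((B *ᵥ (u j).1) i) ^ 2, ∑ j, (u j).2)

/-- State of the weight computation after `k` rounds: the iterate `w⁽ᵏ⁾`, the sum
`w⁽⁰⁾ + ⋯ + w⁽ᵏ⁻¹⁾` of the earlier ones, and the number of solves. -/
structure LewisState (n : ℕ) where
  current : Fin n → ℝ
  total : Fin n → ℝ
  solves : ℕ

/-- `w⁽⁰⁾ = d/n` and `w⁽ᵏ⁺¹⁾ = ApproxLev((W⁽ᵏ⁾)^{1/2-1/p} A, 1/10)`, with fresh randomness. -/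
def lewisLoop (c : ℝ) (A : Matrix (Fin n) (Fin d) ℝ) (p : ℝ) : ℕ → PMF (LewisState n)
  | 0 => PMF.pure ⟨fun _ => (d : ℝ) / n, 0, 0⟩
  | k + 1 => (lewisLoop c A p k).bind fun st =>
      (approxLev c (1 / 10) A fun i => st.current i ^ (1 / 2 - 1 / p : ℝ)).map fun new =>
        ⟨new.1, st.total + st.current, st.solves + new.2⟩

/-- `ApproxLargeWeights(A, p)`: with `T = ⌈10 log n⌉`, the law of the pair of the weights
`3/(2T) · (w⁽⁰⁾ + ⋯ + w⁽ᵀ⁻¹⁾)` and the number of solves. -/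
def approxLargeWeights (c : ℝ) (A : Matrix (Fin n) (Fin d) ℝ) (p : ℝ) :
    PMF ((Fin n → ℝ) × ℕ) :=
  let T : ℕ := ⌈10 * Real.log n⌉₊
  (lewisLoop c A p T).map fun st => ((3 / (2 * (T : ℝ))) • st.total, st.solves)

/-! ### The main loop -/

/-- `κ = κ_p d^{1/p}` with `κ_p = p`. -/
def kappa (d : ℕ) (p : ℝ) : ℝ := p * (d : ℝ) ^ (1 / p)

/-- `α = α_p d^{-(p²-5p+2)/(p(3p-2))}` with `α_p = 1/(1000 p)`. -/
def stepSize (d : ℕ) (p : ℝ) : ℝ :=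
  1 / (1000 * p) * (d : ℝ) ^ (-((p ^ 2 - 5 * p + 2) / (p * (3 * p - 2))))

/-- `τ = τ_p d^{(p-2)(p-1)/(3p-2)}` with `τ_p = 40^p`. -/
def tau (d : ℕ) (p : ℝ) : ℝ := (40 : ℝ) ^ p * (d : ℝ) ^ ((p - 2) * (p - 1) / (3 * p - 2))

/-- The number `T = ⌊α⁻¹ d^{1/p}⌋` of progress steps. -/
def numSteps (d : ℕ) (p : ℝ) : ℕ := ⌊(stepSize d p)⁻¹ * (d : ℝ) ^ (1 / p)⌋₊

/-- The diagonal of `d^{1-2/p} R + S^{p-2}`. -/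
def resistance (d : ℕ) (r : Fin n → ℝ) (p : ℝ) (s : Fin n → ℝ) : Fin n → ℝ :=
  fun i => (d : ℝ) ^ (1 - 2 / p) * r i + s i ^ (p - 2)

/-- `argmin {xᵀ M x | gᵀ x = -1}` for `M = Aᵀ (d^{1-2/p} R + S^{p-2}) A`, computed by one solve as
`-(gᵀ M⁻¹ g)⁻¹ M⁻¹ g`. That this is the minimizer is `quadMin_spec`. -/
def quadMin (A : Matrix (Fin n) (Fin d) ℝ) (g : Fin d → ℝ) (r : Fin n → ℝ) (p : ℝ)
    (s : Fin n → ℝ) : (Fin d → ℝ) × ℕ :=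
  let u := solve A (resistance d r p s) g
  (-((g ⬝ᵥ u.1)⁻¹ • u.1), u.2)

/-- The vector `s` after a boosting step:
`s_i ← (s_i^{p-2} + τ^{2/p} |(A z)_i|^{p-2} / (4 ‖A z‖_p^p))^{1/(p-2)}` for `i ∈ S`, where
`S = {i | s_i ≤ 2^{-p/(p-2)} κ |(A z)_i|}`. -/
def boost (A : Matrix (Fin n) (Fin d) ℝ) (p : ℝ) (s : Fin n → ℝ) (z : Fin d → ℝ) : Fin n → ℝ :=
  fun i =>
    if s i ≤ (2 : ℝ) ^ (-(p / (p - 2))) * kappa d p * |(A *ᵥ z) i| then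
      (s i ^ (p - 2) + tau d p ^ (2 / p) * |(A *ᵥ z) i| ^ (p - 2) /
        (4 * lpNorm p (A *ᵥ z) ^ p)) ^ (1 / (p - 2))
    else s i

/-- Body of the while loop on the pair `(s, z)`: boost `s`, then recompute `z`. -/
def boostBody (A : Matrix (Fin n) (Fin d) ℝ) (g : Fin d → ℝ) (r : Fin n → ℝ) (p : ℝ)
    (a : (Fin n → ℝ) × (Fin d → ℝ)) : ((Fin n → ℝ) × (Fin d → ℝ)) × ℕ :=
  let s₁ := boost A p a.1 a.2
  let z₁ := quadMin A g r p s₁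
  ((s₁, z₁.1), z₁.2)

/-- `WhileRuns cond body a b N`: the loop `while cond do body`, started in `a`, terminates in `b`
after a total of `N` solves. -/
inductive WhileRuns {σ : Type} (cond : σ → Prop) (body : σ → σ × ℕ) : σ → σ → ℕ → Prop
  | done {a : σ} (h : ¬ cond a) : WhileRuns cond body a a 0
  | next {a b : σ} {N : ℕ} (h : cond a) (run : WhileRuns cond body (body a).1 b N) :
      WhileRuns cond body a b ((body a).2 + N)

/-- `OracleRuns A g r p w t y s N`: started from the weights `w`, the first `t` rounds of the for
loop terminate with the iterates `y, s` after a total of `N` solves. -/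
inductive OracleRuns (A : Matrix (Fin n) (Fin d) ℝ) (g : Fin d → ℝ) (r : Fin n → ℝ) (p : ℝ)
    (w : Fin n → ℝ) : ℕ → (Fin d → ℝ) → (Fin n → ℝ) → ℕ → Prop
  | init : OracleRuns A g r p w 0 0 (fun i => w i ^ (1 / p)) 0
  | round {t N M : ℕ} {y z : Fin d → ℝ} {s s₁ : Fin n → ℝ}
      (prev : OracleRuns A g r p w t y s N)
      (loop : WhileRuns (fun a : (Fin n → ℝ) × (Fin d → ℝ) => tau d p ≤ lpNorm p (A *ᵥ a.2) ^ p)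
        (boostBody A g r p) (s, (quadMin A g r p s).1) (s₁, z) M) :
      OracleRuns A g r p w (t + 1) (y + stepSize d p • z)
        (fun i => s₁ i + stepSize d p * |(A *ᵥ z) i|) (N + ((quadMin A g r p s).2 + M))

/-- With the weights `w`, the main loop of `Oracle(A, g, R, p)` terminates and returns
`out = (α T)⁻¹ y` after `N` solves. -/
def OracleReturns (A : Matrix (Fin n) (Fin d) ℝ) (g : Fin d → ℝ) (r : Fin n → ℝ) (p : ℝ)
    (w : Fin n → ℝ) (out : Fin d → ℝ) (N : ℕ) : Prop :=
  ∃ y s, OracleRuns A g r p w (numSteps d p) y s N ∧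
    out = (stepSize d p * (numSteps d p : ℝ))⁻¹ • y

/-! ### Checks: the minimizer, and determinism of the loops -/

theorem quadMin_spec (A : Matrix (Fin n) (Fin d) ℝ) (g : Fin d → ℝ) (r : Fin n → ℝ) (p : ℝ)
    (s : Fin n → ℝ) (hM : (Aᵀ * diagonal (resistance d r p s) * A).PosDef) (hg : g ≠ 0) :
    g ⬝ᵥ (quadMin A g r p s).1 = -1 ∧ ∀ x : Fin d → ℝ, g ⬝ᵥ x = -1 →
      (quadMin A g r p s).1 ⬝ᵥ
        ((Aᵀ * diagonal (resistance d r p s) * A) *ᵥ (quadMin A g r p s).1) ≤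
      x ⬝ᵥ ((Aᵀ * diagonal (resistance d r p s) * A) *ᵥ x) := by
  have hsymm : ∀ (M : Matrix (Fin d) (Fin d) ℝ), M.IsHermitian → ∀ x y : Fin d → ℝ,
      x ⬝ᵥ (M *ᵥ y) = y ⬝ᵥ (M *ᵥ x) := by
    intro M h x y
    have hT : Mᵀ = M := by rw [← conjTranspose_eq_transpose_of_trivial]; exact h
    rw [dotProduct_mulVec, ← mulVec_transpose, hT, dotProduct_comm]
  unfold quadMin solve
  generalize Aᵀ * diagonal (resistance d r p s) * A = M at hM ⊢
  dsimp only
  set u := M⁻¹ *ᵥ g with hu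
  have hMu : M *ᵥ u = g := by
    rw [hu, mulVec_mulVec, mul_nonsing_inv _ ((isUnit_iff_isUnit_det M).1 hM.isUnit), one_mulVec]
  have hu0 : u ≠ 0 := by
    intro h
    rw [h, mulVec_zero] at hMu
    exact hg hMu.symm
  have hq : 0 < g ⬝ᵥ u := by
    have h := hM.dotProduct_mulVec_pos hu0
    rwa [star_trivial, hMu, dotProduct_comm] at h
  set z := -((g ⬝ᵥ u)⁻¹ • u) with hz
  have hgz : g ⬝ᵥ z = -1 := by
    rw [hz, dotProduct_neg, dotProduct_smul, smul_eq_mul, inv_mul_cancel₀ hq.ne']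
  have hMz : M *ᵥ z = -((g ⬝ᵥ u)⁻¹ • g) := by
    rw [hz, mulVec_neg, mulVec_smul, hMu]
  refine ⟨hgz, fun x hx => ?_⟩
  have key : ∀ x, g ⬝ᵥ x = -1 → x ⬝ᵥ (M *ᵥ z) = (g ⬝ᵥ u)⁻¹ := by
    intro x hx
    rw [hMz, dotProduct_neg, dotProduct_smul, dotProduct_comm x g, hx, smul_eq_mul]
    ring
  have h := hM.posSemidef.dotProduct_mulVec_nonneg (x - z)
  rw [star_trivial, mulVec_sub, dotProduct_sub, sub_dotProduct, sub_dotProduct,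
    hsymm M hM.1 z x, key x hx, key z hgz] at h
  rw [key z hgz]
  linarith

theorem WhileRuns.unique {σ : Type} {cond : σ → Prop} {body : σ → σ × ℕ} {a b b₁ : σ}
    {N N₁ : ℕ} (h : WhileRuns cond body a b N) (h₁ : WhileRuns cond body a b₁ N₁) :
    b = b₁ ∧ N = N₁ := by
  induction h generalizing b₁ N₁ with
  | done h =>
    cases h₁ with
    | done _ => exact ⟨rfl, rfl⟩
    | next h2 _ => exact absurd h2 h
  | next h _ ih =>
    cases h₁ with
    | done h2 => exact absurd h h2
    | next _ run => obtain ⟨e, f⟩ := ih run; exact ⟨e, by rw [f]⟩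

theorem OracleRuns.unique {A : Matrix (Fin n) (Fin d) ℝ} {g : Fin d → ℝ} {r : Fin n → ℝ} {p : ℝ}
    {w : Fin n → ℝ} {t N N₁ : ℕ} {y y₁ : Fin d → ℝ} {s s₁ : Fin n → ℝ}
    (h : OracleRuns A g r p w t y s N) (h₁ : OracleRuns A g r p w t y₁ s₁ N₁) :
    y = y₁ ∧ s = s₁ ∧ N = N₁ := by
  induction h generalizing y₁ s₁ N₁ with
  | init => cases h₁; exact ⟨rfl, rfl, rfl⟩
  | round _ loop ih =>
    cases h₁ with
    | round prev2 loop2 =>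
      obtain ⟨rfl, rfl, rfl⟩ := ih prev2
      obtain ⟨e, rfl⟩ := loop.unique loop2
      obtain ⟨rfl, rfl⟩ := Prod.mk.inj e
      exact ⟨rfl, rfl, rfl⟩

end LpOracle

end

/-! For fixed weights the main loop is deterministic and is controlled by two potentials: Φ = ∑
s_i^p and E = `minEnergy`, the least energy over g·x = -1 for the current resistances. Testing with
the promised x_⋆ and applying Hölder gives E ≤ d^{1-2/p} + Φ^{1-2/p} (`minEnergy_le`). A boost
raises E by at least τ^{2/p}/10, and raises Φ by at most κ²/2 times the gain in E (`boost_spec`). A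
progress step does not lower E and raises Φ by at most `growthRate` (`invariant_progress`). Hence Φ
≤ 2d + t · growthRate + (κ²/2) E after t progress steps. As the bound on E is sublinear in Φ, the
two inequalities close up to Φ ≤ (8p)^p d (`sum_rpow_le_of_invariant`). This caps E, hence the
number of boosts. Since |Ay| ≤ s throughout, it also bounds ‖Ay‖_p, while the quadratic term follows
from the cap on E and the triangle inequality.

The Lewis property of the initial weights gives ‖Ax‖_p² ≤ energy of x for all later resistances.
This makes a boost a small relative perturbation of the quadratic form, which is what turns a large
‖Az‖_p into a definite gain in E.

The weights come from a fixed point iteration w ↦ leverage scores of W^{1/2-1/p} A. The iterates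
need not converge, but their average is an overestimate: concavity of t^{1-2/p}, convexity of exp
and concavity of log reduce the error to the telescoping quantity (log w⁽⁰⁾ - log w⁽ᵀ⁾)/T, which is
small once T ≥ 10 log n (`IsAccurateRun.isLewisOverestimate`).

Randomness enters only through the sketches. A leverage score is a squared length ‖u‖², and its
estimate is an average of squares of random sign sums of u. Exponential moments give tails
exp(-k/800) for k rows (`card_inaccurate_le`), and a union bound over rows and rounds finishes the
proof. -/

noncomputable section

namespace LpOracle

variable {n d : ℕ}

/-! ### Scalar inequalities -/

/-- This is Bernoulli's inequality at x/y, multiplied by y^q. -/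
theorem rpow_sub_rpow_le {x y q : ℝ} (hx : 0 ≤ x) (hxy : x ≤ y) (hq : 1 ≤ q) :
    y ^ q - x ^ q ≤ q * (y - x) * y ^ (q - 1) := by
  rcases (hx.trans hxy).eq_or_lt with hy | hy
  · have : x = 0 := le_antisymm (hy ▸ hxy) hx
    subst this; subst hy
    simp
  · have h := one_add_mul_self_le_rpow_one_add (s := (x - y) / y)
      (by rw [le_div_iff₀ hy]; linarith) hq
    have e : 1 + (x - y) / y = x / y := by field_simp; ring
    rw [e, Real.div_rpow hx hy.le, le_div_iff₀ (Real.rpow_pos_of_pos hy q)] at h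
    have e2 : y ^ q = y * y ^ (q - 1) := by
      rw [Real.rpow_sub_one hy.ne']; field_simp
    have e3 : (1 + q * ((x - y) / y)) * y ^ q = y ^ q + q * (x - y) * y ^ (q - 1) := by
      rw [e2]; field_simp
    rw [e3] at h
    linarith

theorem one_add_inv_rpow_le {p : ℝ} (hp : 0 < p) : (1 + 1 / p) ^ p ≤ 3 := by
  have h1 : 1 + 1 / p ≤ Real.exp (1 / p) := by linarith [Real.add_one_le_exp (1 / p)]
  calc (1 + 1 / p) ^ p ≤ Real.exp (1 / p) ^ p := by gcongr
    _ = Real.exp 1 := by rw [← Real.exp_mul]; congr 1; field_simp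
    _ ≤ 3 := by linarith [Real.exp_one_lt_d9]

/-- If p b ≤ s, then s + b ≤ (1 + 1/p) s and (1 + 1/p)^p ≤ 3, so the increment is of first order in
b. If s ≤ p b, the last term alone dominates the left side. -/
theorem add_rpow_le_progress {p s b : ℝ} (hp : 1 ≤ p) (hs : 0 < s) (hb : 0 ≤ b) :
    (s + b) ^ p ≤ s ^ p + 3 * p * b * s ^ (p - 1) + ((p + 1) * b) ^ p := by
  rcases le_total (p * b) s with h | h
  · have h1 := rpow_sub_rpow_le hs.le (show s ≤ s + b by linarith) hp
    have h2 : s + b ≤ (1 + 1 / p) * s := by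
      have : b ≤ s / p := by rw [le_div_iff₀ (by linarith)]; linarith
      calc s + b ≤ s + s / p := by linarith
        _ = _ := by ring
    have h3 : (s + b) ^ (p - 1) ≤ 3 * s ^ (p - 1) := by
      calc (s + b) ^ (p - 1) ≤ ((1 + 1 / p) * s) ^ (p - 1) := by
            apply Real.rpow_le_rpow (by positivity) h2 (by linarith)
        _ = (1 + 1 / p) ^ (p - 1) * s ^ (p - 1) := by
            rw [Real.mul_rpow (by positivity) hs.le]
        _ ≤ (1 + 1 / p) ^ p * s ^ (p - 1) := by
            gcongr
            · simp; positivity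
            · linarith
        _ ≤ 3 * s ^ (p - 1) := by
            gcongr
            exact one_add_inv_rpow_le (by linarith)
    have h4 : 0 ≤ ((p + 1) * b) ^ p := by positivity
    have h5 : p * (s + b - s) * (s + b) ^ (p - 1) ≤ p * b * (3 * s ^ (p - 1)) := by
      rw [add_sub_cancel_left]
      gcongr
    linarith
  · have h1 : (s + b) ^ p ≤ ((p + 1) * b) ^ p := by
      apply Real.rpow_le_rpow (by positivity) (by linarith) (by linarith)
    have h2 : 0 ≤ s ^ p := by positivity
    have h3 : 0 ≤ 3 * p * b * s ^ (p - 1) := by positivity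
    linarith

/-- Growth of `s ^ p` when a small `s` is boosted. -/
theorem boost_rpow_le {p s a κ θ : ℝ} (hp : 2 < p) (hs : 0 < s) (ha : 0 ≤ a) (hκ : 2 ≤ κ)
    (hθ0 : 0 ≤ θ) (hθ : θ ≤ 1 / 4) (hsa : s ≤ (2 : ℝ) ^ (-(p / (p - 2))) * κ * a) :
    ((s ^ (p - 2) + θ * a ^ (p - 2)) ^ (1 / (p - 2))) ^ p ≤
      s ^ p + 3 / 8 * κ ^ 2 * (θ * a ^ (p - 2) * a ^ 2) := by
  have hp2 : 0 < p - 2 := by linarith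
  set X := s ^ (p - 2) with hX
  set δ := θ * a ^ (p - 2) with hδ
  have hX0 : 0 < X := by positivity
  have hδ0 : 0 ≤ δ := by positivity
  set q := p / (p - 2) with hq
  have hq1 : 1 ≤ q := by rw [hq, le_div_iff₀ hp2]; linarith
  have e1 : ((X + δ) ^ (1 / (p - 2))) ^ p = (X + δ) ^ q := by
    rw [← Real.rpow_mul (by positivity)]; congr 1; rw [hq]; ring
  have e2 : X ^ q = s ^ p := by
    rw [hX, ← Real.rpow_mul hs.le]; congr 1; rw [hq]; field_simp
  have eq1 : q - 1 = 2 / (p - 2) := by rw [hq]; field_simp; ring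
  have h1 := rpow_sub_rpow_le hX0.le (show X ≤ X + δ by linarith) hq1
  rw [add_sub_cancel_left] at h1
  -- the boosted value is at most a small multiple of `κ a`
  have hY : X + δ ≤ 2 * ((2 : ℝ) ^ (-p) * (κ * a) ^ (p - 2)) := by
    have hXle : X ≤ (2 : ℝ) ^ (-p) * (κ * a) ^ (p - 2) := by
      calc X ≤ ((2 : ℝ) ^ (-(p / (p - 2))) * κ * a) ^ (p - 2) := by
            rw [hX]; exact Real.rpow_le_rpow hs.le hsa hp2.le
        _ = _ := by
            rw [mul_assoc, Real.mul_rpow (by positivity) (by positivity),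
              ← Real.rpow_mul (by norm_num)]
            congr 2; field_simp
    have hδle : δ ≤ (2 : ℝ) ^ (-p) * (κ * a) ^ (p - 2) := by
      have h2κ : (2 : ℝ) ^ (p - 2) ≤ κ ^ (p - 2) := by gcongr
      have e4 : (2 : ℝ) ^ (-p) * 2 ^ (p - 2) = 1 / 4 := by
        rw [← Real.rpow_add (by norm_num), show -p + (p - 2) = ((-2 : ℤ) : ℝ) by push_cast; ring,
          Real.rpow_intCast]; norm_num
      rw [Real.mul_rpow (by positivity) ha, ← mul_assoc, hδ]
      gcongr
      calc θ ≤ (2 : ℝ) ^ (-p) * 2 ^ (p - 2) := by rw [e4]; exact hθ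
        _ ≤ _ := by gcongr
    linarith
  -- Since (p-2)(q-1) = 2, the power of κ a becomes a square. The factor 1/4 comes from (1-p)(q-1) =
  -- -(q-1) - 2.
  have hYq : (X + δ) ^ (q - 1) ≤ (2 : ℝ) ^ (-(q - 1)) * (1 / 4) * (κ ^ 2 * a ^ 2) := by
    have h0 : 0 ≤ q - 1 := by linarith
    calc (X + δ) ^ (q - 1) ≤ (2 * ((2 : ℝ) ^ (-p) * (κ * a) ^ (p - 2))) ^ (q - 1) :=
          Real.rpow_le_rpow (by positivity) hY h0
      _ = (2 : ℝ) ^ (-(q - 1)) * (1 / 4) * (κ * a) ^ (2 : ℝ) := by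
          rw [← mul_assoc, show (2 : ℝ) * 2 ^ (-p) = 2 ^ (1 - p) by
            rw [sub_eq_add_neg, Real.rpow_add (by norm_num), Real.rpow_one],
            Real.mul_rpow (by positivity) (by positivity), ← Real.rpow_mul (by norm_num),
            ← Real.rpow_mul (by positivity)]
          congr 1
          · rw [show (1 / 4 : ℝ) = 2 ^ (-2 : ℝ) by
              rw [Real.rpow_neg (by norm_num)]; norm_num, ← Real.rpow_add (by norm_num)]
            congr 1; rw [eq1]; field_simp; ring
          · congr 1; rw [eq1]; field_simp
      _ = _ := by rw [Real.rpow_two]; ring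
  -- The slope q = p/(p-2) blows up as p tends to 2. The power of 2 left over from the boosting
  -- threshold absorbs it, so the constant is uniform in p.
  have hqq : q * (2 : ℝ) ^ (-(q - 1)) ≤ 3 / 2 := by
    rw [Real.rpow_neg (by norm_num), ← div_eq_mul_inv, div_le_iff₀ (by positivity)]
    have : 1 + (q - 1) * Real.log 2 ≤ (2 : ℝ) ^ (q - 1) := by
      rw [Real.rpow_def_of_pos (by norm_num)]
      linarith [Real.add_one_le_exp (Real.log 2 * (q - 1))]
    nlinarith [Real.log_two_gt_d9]
  rw [e1, ← e2]
  calc (X + δ) ^ q ≤ X ^ q + q * δ * (X + δ) ^ (q - 1) := by linarith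
    _ ≤ X ^ q + q * δ * ((2 : ℝ) ^ (-(q - 1)) * (1 / 4) * (κ ^ 2 * a ^ 2)) := by gcongr
    _ = X ^ q + (q * (2 : ℝ) ^ (-(q - 1))) * (δ * (1 / 4) * (κ ^ 2 * a ^ 2)) := by ring
    _ ≤ X ^ q + 3 / 2 * (δ * (1 / 4) * (κ ^ 2 * a ^ 2)) := by gcongr
    _ = _ := by ring

/-- Hölder with exponents p/(p-2) and p/2; at p = 2 the first is infinite and the claim is an
equality. It is used with b = |Ax| and with s either the current iterate or |Az|. -/
theorem sum_rpow_mul_sq_le {p : ℝ} (hp : 2 ≤ p) {s b : Fin n → ℝ} (hs : ∀ i, 0 ≤ s i)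
    (hb : ∀ i, 0 ≤ b i) :
    ∑ i, s i ^ (p - 2) * b i ^ 2 ≤ (∑ i, s i ^ p) ^ (1 - 2 / p) * (∑ i, b i ^ p) ^ (2 / p) := by
  rcases hp.eq_or_lt with rfl | hp
  · simp
  · have hp0 : 0 < p := by linarith
    have hp2 : 0 < p - 2 := by linarith
    have hc : (p / (p - 2)).HolderConjugate (p / 2) := by
      rw [Real.holderConjugate_iff]
      refine ⟨by rw [lt_div_iff₀ hp2]; linarith, by field_simp; ring⟩
    have h := Real.inner_le_Lp_mul_Lq_of_nonneg Finset.univ hc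
      (f := fun i => s i ^ (p - 2)) (g := fun i => b i ^ 2)
      (fun i _ => Real.rpow_nonneg (hs i) _) (fun i _ => sq_nonneg _)
    have e1 : ∀ i, (s i ^ (p - 2)) ^ (p / (p - 2)) = s i ^ p := fun i => by
      rw [← Real.rpow_mul (hs i)]; congr 1; field_simp
    have e2 : ∀ i, (b i ^ 2) ^ (p / 2) = b i ^ p := fun i => by
      rw [← Real.rpow_two, ← Real.rpow_mul (hb i)]; congr 1; field_simp
    simp only [e1, e2] at h
    convert h using 3
    · field_simp
    · field_simp

theorem lpNorm_rpow {p : ℝ} (hp : 0 < p) (v : Fin n → ℝ) : lpNorm p v ^ p = ∑ i, |v i| ^ p := by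
  rw [lpNorm, ← Real.rpow_mul (Finset.sum_nonneg fun i _ => by positivity), one_div,
    inv_mul_cancel₀ hp.ne', Real.rpow_one]

theorem sum_rpow_le_one_of_lpNorm {p : ℝ} (hp : 0 < p) {v : Fin n → ℝ} (h : lpNorm p v ≤ 1) :
    ∑ i, |v i| ^ p ≤ 1 := by
  rw [← lpNorm_rpow hp]
  exact Real.rpow_le_one (Real.rpow_nonneg (Finset.sum_nonneg fun i _ => by positivity) _) h hp.le

/-! ### Quadratic forms -/

/-- The energy `∑ ρ_i (A x)_i²` of `x` for the resistances `ρ`. -/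
def energy (A : Matrix (Fin n) (Fin d) ℝ) (ρ : Fin n → ℝ) (x : Fin d → ℝ) : ℝ :=
  ∑ i, ρ i * (A *ᵥ x) i ^ 2

theorem dotProduct_mulVec_gram (A : Matrix (Fin n) (Fin d) ℝ) (ρ : Fin n → ℝ)
    (x y : Fin d → ℝ) :
    x ⬝ᵥ ((Aᵀ * diagonal ρ * A) *ᵥ y) = ∑ i, ρ i * (A *ᵥ x) i * (A *ᵥ y) i := by
  rw [Matrix.mul_assoc, ← mulVec_mulVec, dotProduct_mulVec, vecMul_transpose, ← mulVec_mulVec]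
  simp only [dotProduct, mulVec_diagonal]
  exact Finset.sum_congr rfl fun i _ => by ring

theorem dotProduct_mulVec_gram_self (A : Matrix (Fin n) (Fin d) ℝ) (ρ : Fin n → ℝ)
    (x : Fin d → ℝ) : x ⬝ᵥ ((Aᵀ * diagonal ρ * A) *ᵥ x) = energy A ρ x := by
  rw [dotProduct_mulVec_gram, energy]
  exact Finset.sum_congr rfl fun i _ => by ring

theorem energy_nonneg {A : Matrix (Fin n) (Fin d) ℝ} {ρ : Fin n → ℝ} (h : ∀ i, 0 ≤ ρ i)
    (x : Fin d → ℝ) : 0 ≤ energy A ρ x :=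
  Finset.sum_nonneg fun i _ => mul_nonneg (h i) (sq_nonneg _)

theorem energy_mono {A : Matrix (Fin n) (Fin d) ℝ} {ρ ρ' : Fin n → ℝ} (h : ∀ i, ρ i ≤ ρ' i)
    (x : Fin d → ℝ) : energy A ρ x ≤ energy A ρ' x :=
  Finset.sum_le_sum fun i _ => mul_le_mul_of_nonneg_right (h i) (sq_nonneg _)

theorem injective_mulVec_of_rank_eq {A : Matrix (Fin n) (Fin d) ℝ} (h : A.rank = d) :
    Function.Injective A.mulVec := by
  have h1 := LinearMap.finrank_range_add_finrank_ker A.mulVecLin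
  rw [Matrix.rank] at h
  rw [h, Module.finrank_fin_fun] at h1
  have h2 : Module.finrank ℝ (LinearMap.ker A.mulVecLin) = 0 := by omega
  rw [Submodule.finrank_eq_zero, LinearMap.ker_eq_bot] at h2
  exact h2

theorem posDef_gram {A : Matrix (Fin n) (Fin d) ℝ} (hA : Function.Injective A.mulVec)
    {ρ : Fin n → ℝ} (h0 : ∀ i, 0 ≤ ρ i) (h : ∀ i, ρ i = 0 → ∀ x, (A *ᵥ x) i = 0) :
    (Aᵀ * diagonal ρ * A).PosDef := by
  refine Matrix.PosDef.of_dotProduct_mulVec_pos ?_ fun x hx => ?_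
  · rw [IsHermitian, conjTranspose_eq_transpose_of_trivial]
    simp [Matrix.mul_assoc]
  · rw [star_trivial, dotProduct_mulVec_gram_self]
    refine lt_of_le_of_ne (energy_nonneg h0 x) fun he => hx ?_
    have h1 := (Finset.sum_eq_zero_iff_of_nonneg
      fun i _ => mul_nonneg (h0 i) (sq_nonneg ((A *ᵥ x) i))).1 he.symm
    apply hA
    rw [mulVec_zero]
    funext i
    rcases mul_eq_zero.1 (h1 i (Finset.mem_univ i)) with h2 | h2
    · exact h i h2 x
    · exact pow_eq_zero_iff (two_ne_zero) |>.1 h2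

/-- Second order expansion of the energy at a minimizer over an affine hyperplane. -/
theorem energy_eq_of_minimizer {A : Matrix (Fin n) (Fin d) ℝ} {ρ : Fin n → ℝ} {g z : Fin d → ℝ}
    (h0 : ∀ i, 0 ≤ ρ i) (hz : g ⬝ᵥ z = -1)
    (hmin : ∀ x, g ⬝ᵥ x = -1 → energy A ρ z ≤ energy A ρ x) {x : Fin d → ℝ}
    (hx : g ⬝ᵥ x = -1) : energy A ρ x = energy A ρ z + energy A ρ (x - z) := by
  set B := ∑ i, ρ i * (A *ᵥ z) i * (A *ᵥ (x - z)) i with hB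
  have hexp : ∀ t : ℝ, energy A ρ (z + t • (x - z)) =
      energy A ρ z + 2 * t * B + t ^ 2 * energy A ρ (x - z) := fun t => by
    simp only [energy, hB, Finset.mul_sum, ← Finset.sum_add_distrib]
    refine Finset.sum_congr rfl fun i _ => ?_
    rw [mulVec_add, mulVec_smul]
    simp only [Pi.add_apply, Pi.smul_apply, smul_eq_mul]
    ring
  have hge : ∀ t : ℝ, 0 ≤ 2 * t * B + t ^ 2 * energy A ρ (x - z) := fun t => by
    have h1 := hmin (z + t • (x - z)) (by
      rw [dotProduct_add, dotProduct_smul, dotProduct_sub, hx, hz]; simp)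
    rw [hexp] at h1
    linarith
  have hC := energy_nonneg (A := A) h0 (x - z)
  have hB0 : B = 0 := by
    set C := energy A ρ (x - z)
    -- The optimal t would be -B/C; the denominator C + 1 avoids the case C = 0 and still makes the
    -- quadratic negative unless the cross term B vanishes.
    have h1 := hge (-B / (C + 1))
    have h2 : 2 * (-B / (C + 1)) * B + (-B / (C + 1)) ^ 2 * C =
        -(B ^ 2 * (C + 2) / (C + 1) ^ 2) := by
      field_simp; ring
    rw [h2] at h1
    by_contra hne
    have : 0 < B ^ 2 * (C + 2) / (C + 1) ^ 2 := by positivity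
    linarith
  have h1 := hexp 1
  rw [one_smul, add_sub_cancel, hB0] at h1
  linarith

/-- By the exact expansion at z, the new energy at x exceeds the old minimum by energy ρ (x - z) +
energy δ x ≥ 4 energy δ (x - z) + energy δ x. Coordinatewise, 4(a - b)² + a² ≥ (4/5) b², whatever x
is. -/
theorem energy_add_le_of_minimizer {A : Matrix (Fin n) (Fin d) ℝ} {ρ ρ' δ : Fin n → ℝ}
    {g z x : Fin d → ℝ} (h0 : ∀ i, 0 ≤ ρ i) (hz : g ⬝ᵥ z = -1)
    (hmin : ∀ x, g ⬝ᵥ x = -1 → energy A ρ z ≤ energy A ρ x) (hδ : ∀ i, 0 ≤ δ i)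
    (hρ' : ∀ i, ρ' i = ρ i + δ i) (hδρ : ∀ x, 4 * energy A δ x ≤ energy A ρ x)
    (hx : g ⬝ᵥ x = -1) : energy A ρ z + 4 / 5 * energy A δ z ≤ energy A ρ' x := by
  have h1 := energy_eq_of_minimizer h0 hz hmin hx
  have h2 : energy A ρ' x = energy A ρ x + energy A δ x := by
    simp only [energy, ← Finset.sum_add_distrib]
    exact Finset.sum_congr rfl fun i _ => by rw [hρ' i]; ring
  have h3 : 4 / 5 * energy A δ z ≤ 4 * energy A δ (x - z) + energy A δ x := by
    simp only [energy, Finset.mul_sum, ← Finset.sum_add_distrib]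
    refine Finset.sum_le_sum fun i _ => ?_
    rw [mulVec_sub, Pi.sub_apply]
    have := mul_nonneg (hδ i) (sq_nonneg (5 * (A *ᵥ x) i - 4 * (A *ᵥ z) i))
    nlinarith
  linarith [hδρ (x - z)]

/-! ### The weights and the minimizer -/

/-- `w` is a vector of positive `ℓ_p` Lewis weight overestimates of `A` of total mass `≤ 2 d`. -/
structure IsLewisOverestimate (A : Matrix (Fin n) (Fin d) ℝ) (p : ℝ) (w : Fin n → ℝ) : Prop where
  pos : ∀ i, 0 < w i
  sum_le : ∑ i, w i ≤ 2 * d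
  sq_le : ∀ x i, (A *ᵥ x) i ^ 2 ≤ w i ^ (2 / p) * energy A (fun j => w j ^ (1 - 2 / p)) x

/-- Write |Ax|^p as (Ax)² times its power p/2 - 1 and bound the latter by the pointwise Lewis
inequality: the powers of w combine to w^{1-2/p}, and the sum becomes Q^{p/2-1} · Q. -/
theorem IsLewisOverestimate.sum_rpow_le {A : Matrix (Fin n) (Fin d) ℝ} {p : ℝ} {w : Fin n → ℝ}
    (h : IsLewisOverestimate A p w) (hp : 2 ≤ p) (x : Fin d → ℝ) :
    (∑ i, |(A *ᵥ x) i| ^ p) ^ (2 / p) ≤ energy A (fun j => w j ^ (1 - 2 / p)) x := by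
  have hp0 : 0 < p := by linarith
  set Q := energy A (fun j => w j ^ (1 - 2 / p)) x with hQ
  have hQ0 : 0 ≤ Q := energy_nonneg (fun i => Real.rpow_nonneg (h.pos i).le _) x
  have h1 : ∑ i, |(A *ᵥ x) i| ^ p ≤ Q ^ (p / 2) := by
    calc ∑ i, |(A *ᵥ x) i| ^ p
        ≤ ∑ i, Q ^ (p / 2 - 1) * (w i ^ (1 - 2 / p) * (A *ᵥ x) i ^ 2) := by
          refine Finset.sum_le_sum fun i _ => ?_
          rcases eq_or_ne ((A *ᵥ x) i) 0 with h0 | h0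
          · rw [h0]; simp [Real.zero_rpow hp0.ne']
          have hsplit : |(A *ᵥ x) i| ^ p = ((A *ᵥ x) i ^ 2) ^ (p / 2 - 1) * (A *ᵥ x) i ^ 2 := by
            rw [← sq_abs, ← Real.rpow_natCast, ← Real.rpow_mul (abs_nonneg _),
              ← Real.rpow_add (abs_pos.2 h0)]
            congr 1; push_cast; ring
          have h2 : ((A *ᵥ x) i ^ 2) ^ (p / 2 - 1) ≤ w i ^ (1 - 2 / p) * Q ^ (p / 2 - 1) := by
            calc ((A *ᵥ x) i ^ 2) ^ (p / 2 - 1) ≤ (w i ^ (2 / p) * Q) ^ (p / 2 - 1) :=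
                  Real.rpow_le_rpow (sq_nonneg _) (h.sq_le x i) (by linarith)
              _ = _ := by
                  rw [Real.mul_rpow (Real.rpow_nonneg (h.pos i).le _) hQ0,
                    ← Real.rpow_mul (h.pos i).le]
                  congr 2; field_simp
          rw [hsplit]
          calc _ ≤ w i ^ (1 - 2 / p) * Q ^ (p / 2 - 1) * (A *ᵥ x) i ^ 2 :=
                mul_le_mul_of_nonneg_right h2 (sq_nonneg _)
            _ = _ := by ring
      _ = Q ^ (p / 2 - 1) * Q := by rw [← Finset.mul_sum]; rfl
      _ = Q ^ (p / 2) := by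
          rcases hQ0.eq_or_lt with h0 | h0
          · rw [← h0, mul_zero, Real.zero_rpow (by positivity)]
          · rw [Real.rpow_sub_one h0.ne']; field_simp
  calc (∑ i, |(A *ᵥ x) i| ^ p) ^ (2 / p) ≤ (Q ^ (p / 2)) ^ (2 / p) :=
        Real.rpow_le_rpow (Finset.sum_nonneg fun i _ => by positivity) h1 (by positivity)
    _ = Q := by
        rw [← Real.rpow_mul hQ0, show p / 2 * (2 / p) = 1 by field_simp, Real.rpow_one]

/-- The standing assumptions on the input of the main loop. -/
structure OracleInput (A : Matrix (Fin n) (Fin d) ℝ) (g : Fin d → ℝ) (r : Fin n → ℝ) (p : ℝ)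
    (w : Fin n → ℝ) : Prop where
  two_le : 2 ≤ p
  injective : Function.Injective A.mulVec
  residual : IsScaledResidual A g r p
  lewis : IsLewisOverestimate A p w

namespace OracleInput

variable {A : Matrix (Fin n) (Fin d) ℝ} {g : Fin d → ℝ} {r : Fin n → ℝ} {p : ℝ}
  {w s s' : Fin n → ℝ}

theorem p_pos (H : OracleInput A g r p w) : 0 < p := by linarith [H.two_le]

theorem g_ne_zero (H : OracleInput A g r p w) : g ≠ 0 := by
  rintro rfl
  obtain ⟨-, x, hx, -⟩ := H.residual
  simp at hx

theorem one_le_d (H : OracleInput A g r p w) : (1 : ℝ) ≤ d := by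
  rcases Nat.eq_zero_or_pos d with rfl | h
  · exact absurd (Subsingleton.elim g 0) H.g_ne_zero
  · exact_mod_cast h

theorem resistance_pos (H : OracleInput A g r p w) (hs : ∀ i, 0 < s i) (i : Fin n) :
    0 < resistance d r p s i := by
  have h1 := H.residual.1 i
  have h2 : 0 < s i ^ (p - 2) := Real.rpow_pos_of_pos (hs i) _
  unfold resistance
  positivity

theorem posDef (H : OracleInput A g r p w) (hs : ∀ i, 0 < s i) :
    (Aᵀ * diagonal (resistance d r p s) * A).PosDef :=
  posDef_gram H.injective (fun i => (H.resistance_pos hs i).le)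
    fun i h => absurd h (H.resistance_pos hs i).ne'

theorem dotProduct_quadMin (H : OracleInput A g r p w) (hs : ∀ i, 0 < s i) :
    g ⬝ᵥ (quadMin A g r p s).1 = -1 :=
  (quadMin_spec A g r p s (H.posDef hs) H.g_ne_zero).1

theorem energy_quadMin_le (H : OracleInput A g r p w) (hs : ∀ i, 0 < s i) (x : Fin d → ℝ)
    (hx : g ⬝ᵥ x = -1) :
    energy A (resistance d r p s) (quadMin A g r p s).1 ≤ energy A (resistance d r p s) x := by
  have h := (quadMin_spec A g r p s (H.posDef hs) H.g_ne_zero).2 x hx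
  rwa [dotProduct_mulVec_gram_self, dotProduct_mulVec_gram_self] at h

end OracleInput

/-- The energy of the minimizer for the current resistances. -/
def minEnergy (A : Matrix (Fin n) (Fin d) ℝ) (g : Fin d → ℝ) (r : Fin n → ℝ) (p : ℝ)
    (s : Fin n → ℝ) : ℝ :=
  energy A (resistance d r p s) (quadMin A g r p s).1

namespace OracleInput

variable {A : Matrix (Fin n) (Fin d) ℝ} {g : Fin d → ℝ} {r : Fin n → ℝ} {p : ℝ}
  {w s s' : Fin n → ℝ}

theorem minEnergy_nonneg (H : OracleInput A g r p w) (hs : ∀ i, 0 < s i) :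
    0 ≤ minEnergy A g r p s :=
  energy_nonneg (fun i => (H.resistance_pos hs i).le) _

theorem minEnergy_mono (H : OracleInput A g r p w) (hs : ∀ i, 0 < s i) (h : ∀ i, s i ≤ s' i) :
    minEnergy A g r p s ≤ minEnergy A g r p s' := by
  have hs' : ∀ i, 0 < s' i := fun i => (hs i).trans_le (h i)
  refine (H.energy_quadMin_le hs _ (H.dotProduct_quadMin hs')).trans (energy_mono (fun i => ?_) _)
  have := Real.rpow_le_rpow (hs i).le (h i) (show 0 ≤ p - 2 by linarith [H.two_le])
  unfold resistance
  linarith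

theorem energy_resistance (x : Fin d → ℝ) :
    energy A (resistance d r p s) x =
      (d : ℝ) ^ (1 - 2 / p) * energy A r x + ∑ i, s i ^ (p - 2) * (A *ᵥ x) i ^ 2 := by
  simp only [energy, Finset.mul_sum, ← Finset.sum_add_distrib, resistance]
  exact Finset.sum_congr rfl fun i _ => by ring

/-- The promised solution x_⋆ is a competitor; Hölder bounds its energy because ‖A x_⋆‖_p ≤ 1. -/
theorem minEnergy_le (H : OracleInput A g r p w) (hs : ∀ i, 0 < s i) :
    minEnergy A g r p s ≤ (d : ℝ) ^ (1 - 2 / p) + (∑ i, s i ^ p) ^ (1 - 2 / p) := by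
  obtain ⟨-, x, hx, hR, hx1⟩ := H.residual
  rw [dotProduct_mulVec_gram_self] at hR
  refine (H.energy_quadMin_le hs x hx).trans ?_
  rw [energy_resistance]
  have h1 := sum_rpow_mul_sq_le H.two_le (fun i => (hs i).le)
    (fun i => abs_nonneg ((A *ᵥ x) i))
  simp only [sq_abs] at h1
  have h2 : (∑ i, |(A *ᵥ x) i| ^ p) ^ (2 / p) ≤ 1 :=
    Real.rpow_le_one (Finset.sum_nonneg fun i _ => by positivity)
      (sum_rpow_le_one_of_lpNorm H.p_pos hx1) (by have := H.p_pos; positivity)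
  have h3 : 0 ≤ (∑ i, s i ^ p) ^ (1 - 2 / p) :=
    Real.rpow_nonneg (Finset.sum_nonneg fun i _ => Real.rpow_nonneg (hs i).le _) _
  have h4 : 0 ≤ (d : ℝ) ^ (1 - 2 / p) := by positivity
  nlinarith

/-- `∑ s_i^{p-2} (A z)_i²` is at most the energy of `z`. -/
theorem sum_le_minEnergy (H : OracleInput A g r p w) :
    ∑ i, s i ^ (p - 2) * (A *ᵥ (quadMin A g r p s).1) i ^ 2 ≤ minEnergy A g r p s := by
  rw [minEnergy, energy_resistance]
  have := energy_nonneg (A := A) H.residual.1 (quadMin A g r p s).1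
  have : 0 ≤ (d : ℝ) ^ (1 - 2 / p) * energy A r (quadMin A g r p s).1 := by positivity
  linarith

theorem energy_r_le (hs : ∀ i, 0 < s i) :
    (d : ℝ) ^ (1 - 2 / p) * energy A r (quadMin A g r p s).1 ≤ minEnergy A g r p s := by
  rw [minEnergy, energy_resistance]
  have : 0 ≤ ∑ i, s i ^ (p - 2) * (A *ᵥ (quadMin A g r p s).1) i ^ 2 :=
    Finset.sum_nonneg fun i _ => mul_nonneg (Real.rpow_nonneg (hs i).le _) (sq_nonneg _)
  linarith

/-- Since s only grows from w^{1/p}, the resistances keep dominating w^{1-2/p}, so the Lewis bound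
stays available throughout the loop. -/
theorem sum_rpow_le_energy (H : OracleInput A g r p w) (hs : ∀ i, w i ^ (1 / p) ≤ s i)
    (x : Fin d → ℝ) :
    (∑ i, |(A *ᵥ x) i| ^ p) ^ (2 / p) ≤ energy A (resistance d r p s) x := by
  refine (H.lewis.sum_rpow_le H.two_le x).trans (energy_mono (fun i => ?_) x)
  have hw := H.lewis.pos i
  have h1 : w i ^ (1 - 2 / p) ≤ s i ^ (p - 2) := by
    calc w i ^ (1 - 2 / p) = (w i ^ (1 / p)) ^ (p - 2) := by
          rw [← Real.rpow_mul hw.le]; congr 1; have := H.p_pos; field_simp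
      _ ≤ _ := Real.rpow_le_rpow (by positivity) (hs i) (by linarith [H.two_le])
  have := H.residual.1 i
  have : 0 ≤ (d : ℝ) ^ (1 - 2 / p) * r i := by positivity
  unfold resistance
  linarith

/-! ### The effect of a boosting step -/

theorem minEnergy_le_of_sum_le (H : OracleInput A g r p w) (hs : ∀ i, 0 < s i)
    (hΦ : ∑ i, s i ^ p ≤ (8 * p) ^ p * d) :
    minEnergy A g r p s ≤ 2 * (8 * p) ^ (p - 2) * (d : ℝ) ^ (1 - 2 / p) := by
  have hp := H.two_le
  have hp0 := H.p_pos
  have h1 : (∑ i, s i ^ p) ^ (1 - 2 / p) ≤ (8 * p) ^ (p - 2) * (d : ℝ) ^ (1 - 2 / p) := by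
    have h0 : 0 ≤ 1 - 2 / p := by
      rw [sub_nonneg, div_le_one hp0]; exact hp
    calc _ ≤ ((8 * p) ^ p * d) ^ (1 - 2 / p) :=
          Real.rpow_le_rpow
            (Finset.sum_nonneg fun i _ => Real.rpow_nonneg (hs i).le _) hΦ h0
      _ = _ := by
          rw [Real.mul_rpow (by positivity) (by positivity), ← Real.rpow_mul (by positivity)]
          congr 2; field_simp
  have h2 : (1 : ℝ) ≤ (8 * p) ^ (p - 2) := Real.one_le_rpow (by linarith) (by linarith)
  have h3 : 0 ≤ (d : ℝ) ^ (1 - 2 / p) := by positivity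
  have := H.minEnergy_le hs
  nlinarith

theorem rpow_le_tau (H : OracleInput A g r p w) :
    (40 : ℝ) ^ p ≤ tau d p := by
  have hp := H.two_le
  have : (1 : ℝ) ≤ (d : ℝ) ^ ((p - 2) * (p - 1) / (3 * p - 2)) := by
    apply Real.one_le_rpow H.one_le_d
    apply div_nonneg
    · apply mul_nonneg <;> linarith
    · linarith
  have h40 : 0 < (40 : ℝ) ^ p := by positivity
  unfold tau
  nlinarith

theorem tau_pos (H : OracleInput A g r p w) : 0 < tau d p :=
  lt_of_lt_of_le (by positivity) H.rpow_le_tau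

/-- At p = 2 the energy is at most 1 + 1, whereas τ ≥ 40². So no boost occurs and the exponent
1/(p-2) is never used. -/
theorem sum_lt_tau_of_eq_two (H : OracleInput A g r p w) (hs : ∀ i, 0 < s i) (hp : p = 2) :
    lpNorm p (A *ᵥ (quadMin A g r p s).1) ^ p < tau d p := by
  have h1 := H.sum_le_minEnergy (s := s)
  have h2 := H.minEnergy_le hs
  have h3 := H.rpow_le_tau
  rw [lpNorm_rpow H.p_pos]
  subst hp
  norm_num at h1 h2 h3 ⊢
  linarith

/-- On an unboosted coordinate s_i is large compared with |(Az)_i|, so its share of ‖Az‖_p^p is paid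
for by the energy. The cap on the energy makes these shares total at most 16^p/32 ≤ τ/2, and the
boosted coordinates carry the rest. -/
theorem sum_boosted_ge (H : OracleInput A g r p w) (hp : 2 < p) (hs : ∀ i, 0 < s i)
    (hΦ : ∑ i, s i ^ p ≤ (8 * p) ^ p * d)
    (hτ : tau d p ≤ lpNorm p (A *ᵥ (quadMin A g r p s).1) ^ p) (P : Fin n → Prop)
    [DecidablePred P]
    (hP : ∀ i, P i ↔ s i ≤ (2 : ℝ) ^ (-(p / (p - 2))) * kappa d p *
      |(A *ᵥ (quadMin A g r p s).1) i|) :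
    lpNorm p (A *ᵥ (quadMin A g r p s).1) ^ p / 2 ≤
      ∑ i, if P i then |(A *ᵥ (quadMin A g r p s).1) i| ^ p else 0 := by
  set z := (quadMin A g r p s).1 with hz
  have hd := H.one_le_d
  have hd0 : (0 : ℝ) < d := by linarith
  have hp0 := H.p_pos
  have hp2 : 0 < p - 2 := by linarith
  set c := (2 : ℝ) ^ (-(p / (p - 2))) * kappa d p with hc
  have hκ : 0 < kappa d p := by unfold kappa; positivity
  have hc0 : 0 < c := by positivity
  have hcp : c ^ (p - 2) = 2 ^ (-p) * (p ^ (p - 2) * (d : ℝ) ^ (1 - 2 / p)) := by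
    rw [hc, kappa, Real.mul_rpow (by positivity) (by positivity),
      Real.mul_rpow (by positivity) (by positivity), ← Real.rpow_mul (by norm_num),
      ← Real.rpow_mul (by positivity)]
    congr 2
    · field_simp
    · congr 1; field_simp
  have h1 : ∑ i, (if P i then 0 else |(A *ᵥ z) i| ^ p) * c ^ (p - 2) ≤ minEnergy A g r p s := by
    refine le_trans (Finset.sum_le_sum fun i _ => ?_) (H.sum_le_minEnergy (s := s))
    split_ifs with h
    · rw [zero_mul]; exact mul_nonneg (Real.rpow_nonneg (hs i).le _) (sq_nonneg _)
    · rw [hP, not_le] at h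
      rcases eq_or_ne ((A *ᵥ z) i) 0 with h0 | h0
      · rw [← hz, h0]; simp [Real.zero_rpow hp0.ne']
      rw [← hz, ← sq_abs ((A *ᵥ z) i),
        show |(A *ᵥ z) i| ^ p = |(A *ᵥ z) i| ^ (p - 2) * |(A *ᵥ z) i| ^ 2 by
          rw [← Real.rpow_natCast, ← Real.rpow_add (abs_pos.2 h0)]; norm_num]
      calc _ = (c * |(A *ᵥ z) i|) ^ (p - 2) * |(A *ᵥ z) i| ^ 2 := by
            rw [Real.mul_rpow hc0.le (abs_nonneg _)]; ring
        _ ≤ _ := by gcongr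
  have h2 : ∑ i, (if P i then 0 else |(A *ᵥ z) i| ^ p) ≤ tau d p / 2 := by
    rw [← Finset.sum_mul] at h1
    have h3 := h1.trans (H.minEnergy_le_of_sum_le hs hΦ)
    rw [hcp] at h3
    have h4 : (∑ i, (if P i then 0 else |(A *ᵥ z) i| ^ p)) ≤ 2 * 2 ^ p * 8 ^ (p - 2) := by
      have e1 : (8 * p) ^ (p - 2) = 8 ^ (p - 2) * p ^ (p - 2) :=
        Real.mul_rpow (by norm_num) hp0.le
      rw [e1, Real.rpow_neg (by norm_num)] at h3
      set X := p ^ (p - 2) * (d : ℝ) ^ (1 - 2 / p) with hX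
      have hX0 : 0 < X := by positivity
      have h5 : (∑ i, (if P i then 0 else |(A *ᵥ z) i| ^ p)) * ((2 ^ p)⁻¹ * X) ≤
          2 * 2 ^ p * 8 ^ (p - 2) * ((2 ^ p)⁻¹ * X) := by
        refine h3.trans (le_of_eq ?_)
        rw [hX]; field_simp
      exact le_of_mul_le_mul_right h5 (by positivity)
    have h5 : 2 * (2 : ℝ) ^ p * 8 ^ (p - 2) ≤ 40 ^ p / 2 := by
      have e8 : (8 : ℝ) ^ (p - 2) = 8 ^ p / 64 := by
        rw [Real.rpow_sub (by norm_num)]; norm_num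
      have e16 : (2 : ℝ) ^ p * 8 ^ p = 16 ^ p := by
        rw [← Real.mul_rpow (by norm_num) (by norm_num)]; norm_num
      have e40 : (16 : ℝ) ^ p ≤ 40 ^ p := by gcongr; norm_num
      have : (0 : ℝ) < 40 ^ p := by positivity
      rw [e8]
      nlinarith
    linarith [H.rpow_le_tau]
  have h3 : (∑ i, if P i then |(A *ᵥ z) i| ^ p else 0) +
      ∑ i, (if P i then 0 else |(A *ᵥ z) i| ^ p) = lpNorm p (A *ᵥ z) ^ p := by
    rw [lpNorm_rpow hp0, ← Finset.sum_add_distrib]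
    exact Finset.sum_congr rfl fun i _ => by split_ifs <;> simp
  linarith

theorem two_le_kappa (H : OracleInput A g r p w) : 2 ≤ kappa d p := by
  have h : (1 : ℝ) ≤ (d : ℝ) ^ (1 / p) :=
    Real.one_le_rpow H.one_le_d (by have := H.p_pos; positivity)
  unfold kappa
  nlinarith [H.two_le]

/-- The increment δ of the resistances is small as a quadratic form: by Hölder, the choice of θ and
the Lewis bound, 4 energy δ ≤ energy. So E gains at least (4/5) energy δ z, and energy δ z ≥ θ N/2 =
τ^{2/p}/8. The growth of Φ is charged to the same quantity energy δ z, hence to the gain in E. -/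
theorem boost_spec (H : OracleInput A g r p w) (hp : 2 < p) (hs : ∀ i, w i ^ (1 / p) ≤ s i)
    (hΦ : ∑ i, s i ^ p ≤ (8 * p) ^ p * d)
    (hτ : tau d p ≤ lpNorm p (A *ᵥ (quadMin A g r p s).1) ^ p)
    (hs' : s' = boost A p s (quadMin A g r p s).1) :
    (∀ i, s i ≤ s' i) ∧
    minEnergy A g r p s + tau d p ^ (2 / p) / 10 ≤ minEnergy A g r p s' ∧
    ∑ i, s' i ^ p ≤ ∑ i, s i ^ p +
      kappa d p ^ 2 / 2 * (minEnergy A g r p s' - minEnergy A g r p s) := by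
  classical
  have hp0 := H.p_pos
  have hp2 : 0 < p - 2 := by linarith
  have hs0 : ∀ i, 0 < s i := fun i =>
    (Real.rpow_pos_of_pos (H.lewis.pos i) _).trans_le (hs i)
  have hτ0 := H.tau_pos
  set z := (quadMin A g r p s).1 with hz
  set N := lpNorm p (A *ᵥ z) ^ p with hN
  have hN0 : 0 < N := hτ0.trans_le hτ
  set θ := tau d p ^ (2 / p) / (4 * N) with hθ
  have hθ0 : 0 ≤ θ := by positivity
  have hθN : θ * N ^ (1 - 2 / p) ≤ 1 / 4 := by
    have h1 : tau d p ^ (2 / p) ≤ N ^ (2 / p) := by gcongr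
    rw [Real.rpow_sub hN0, Real.rpow_one, hθ]
    have : tau d p ^ (2 / p) / (4 * N) * (N / N ^ (2 / p)) =
        tau d p ^ (2 / p) / N ^ (2 / p) / 4 := by field_simp
    rw [this]
    have := (div_le_one (by positivity)).2 h1
    linarith
  have hN1 : 1 ≤ N := (Real.one_le_rpow (by norm_num) hp0.le).trans (H.rpow_le_tau.trans hτ)
  have hθ4 : θ ≤ 1 / 4 := by
    have : 1 ≤ N ^ (1 - 2 / p) := Real.one_le_rpow hN1 (by
      rw [sub_nonneg, div_le_one hp0]; exact hp.le)
    nlinarith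
  set P : Fin n → Prop := fun i => s i ≤ (2 : ℝ) ^ (-(p / (p - 2))) * kappa d p * |(A *ᵥ z) i|
    with hP
  set δ : Fin n → ℝ := fun i => if P i then θ * |(A *ᵥ z) i| ^ (p - 2) else 0 with hδ
  have hδ0 : ∀ i, 0 ≤ δ i := fun i => by
    simp only [hδ]; split_ifs <;> positivity
  have hδle : ∀ i, δ i ≤ θ * |(A *ᵥ z) i| ^ (p - 2) := fun i => by
    simp only [hδ]; split_ifs
    · exact le_rfl
    · positivity
  have hs'eq : ∀ i, s' i = if P i then
      (s i ^ (p - 2) + θ * |(A *ᵥ z) i| ^ (p - 2)) ^ (1 / (p - 2)) else s i := fun i => by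
    rw [hs', boost]
    simp only [hP]
    congr 3
    rw [hθ, hN]
    ring
  have hs'pow : ∀ i, s' i ^ (p - 2) = s i ^ (p - 2) + δ i := fun i => by
    rw [hs'eq i]
    simp only [hδ]
    split_ifs
    · rw [← Real.rpow_mul (by have := hs0 i; positivity), one_div, inv_mul_cancel₀ hp2.ne',
        Real.rpow_one]
    · rw [add_zero]
  have hs'0 : ∀ i, 0 < s' i := fun i => by
    rw [hs'eq i]
    have := hs0 i
    split_ifs <;> positivity
  have hmono : ∀ i, s i ≤ s' i := fun i => by
    rw [← Real.rpow_le_rpow_iff (hs0 i).le (hs'0 i).le hp2, hs'pow i]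
    linarith [hδ0 i]
  have hδz : energy A δ z = θ * ∑ i, if P i then |(A *ᵥ z) i| ^ p else 0 := by
    rw [energy, Finset.mul_sum]
    refine Finset.sum_congr rfl fun i _ => ?_
    simp only [hδ]
    split_ifs
    · rcases eq_or_ne ((A *ᵥ z) i) 0 with h0 | h0
      · rw [h0]; simp [Real.zero_rpow hp0.ne']
      · rw [← sq_abs, mul_assoc, ← Real.rpow_natCast (|(A *ᵥ z) i|) 2,
          ← Real.rpow_add (abs_pos.2 h0)]; norm_num
    · simp
  have hδρ : ∀ x, 4 * energy A δ x ≤ energy A (resistance d r p s) x := fun x => by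
    have h1 := sum_rpow_mul_sq_le H.two_le (fun i => abs_nonneg ((A *ᵥ z) i))
      (fun i => abs_nonneg ((A *ᵥ x) i))
    rw [← lpNorm_rpow hp0, ← hN] at h1
    have h2 : energy A δ x ≤ θ * ∑ i, |(A *ᵥ z) i| ^ (p - 2) * |(A *ᵥ x) i| ^ 2 := by
      rw [energy, Finset.mul_sum]
      refine Finset.sum_le_sum fun i _ => ?_
      rw [sq_abs, ← mul_assoc]
      exact mul_le_mul_of_nonneg_right (hδle i) (sq_nonneg _)
    have h3 := H.sum_rpow_le_energy hs x
    have h4 : 0 ≤ (∑ i, |(A *ᵥ x) i| ^ p) ^ (2 / p) :=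
      Real.rpow_nonneg (Finset.sum_nonneg fun i _ => by positivity) _
    have h5 := mul_le_mul_of_nonneg_left h1 hθ0
    nlinarith
  have hgain : minEnergy A g r p s + 4 / 5 * energy A δ z ≤ minEnergy A g r p s' :=
    energy_add_le_of_minimizer (fun i => (H.resistance_pos hs0 i).le)
      (H.dotProduct_quadMin hs0) (H.energy_quadMin_le hs0) hδ0
      (fun i => by rw [resistance, resistance, hs'pow i]; ring) hδρ
      (H.dotProduct_quadMin hs'0)
  refine ⟨hmono, ?_, ?_⟩
  · have h1 := H.sum_boosted_ge hp hs0 hΦ hτ P (fun i => Iff.rfl)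
    have h2 := mul_le_mul_of_nonneg_left h1 hθ0
    rw [← hz, ← hN, ← hδz] at h2
    have h3 : θ * (N / 2) = tau d p ^ (2 / p) / 8 := by rw [hθ]; field_simp; norm_num
    linarith
  -- Here energy δ z is at most 5/4 of the gain in E, and 3/8 · 5/4 = 15/32 ≤ 1/2.
  · have h1 : ∑ i, s' i ^ p ≤ ∑ i, s i ^ p + 3 / 8 * kappa d p ^ 2 * energy A δ z := by
      rw [energy, Finset.mul_sum, ← Finset.sum_add_distrib]
      refine Finset.sum_le_sum fun i _ => ?_
      rw [hs'eq i]
      simp only [hδ]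
      split_ifs with h
      · have := boost_rpow_le hp (hs0 i) (abs_nonneg ((A *ᵥ z) i)) H.two_le_kappa hθ0 hθ4 h
        rwa [sq_abs] at this
      · simp
    have h2 := mul_le_mul_of_nonneg_left hgain (sq_nonneg (kappa d p))
    have h3 := mul_nonneg (sq_nonneg (kappa d p)) (energy_nonneg (A := A) hδ0 z)
    nlinarith

end OracleInput

/-! ### Parameters -/

theorem stepSize_pos {p : ℝ} (hp : 0 < p) (hd : (0 : ℝ) < d) : 0 < stepSize d p := by
  unfold stepSize; positivity

theorem inv_stepSize_mul {p : ℝ} (hp : 2 ≤ p) (hd : (0 : ℝ) < d) :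
    (stepSize d p)⁻¹ * (d : ℝ) ^ (1 / p) = 1000 * p * (d : ℝ) ^ ((p - 2) / (3 * p - 2)) := by
  have h3 : 3 * p - 2 ≠ 0 := by linarith
  have hp0 : 0 < p := by linarith
  rw [stepSize, mul_inv, ← Real.rpow_neg hd.le, neg_neg, one_div, inv_inv, mul_assoc,
    ← Real.rpow_add hd]
  congr 2
  obtain ⟨q, hq⟩ : ∃ q, q = 3 * p - 2 := ⟨_, rfl⟩
  rw [← hq] at h3 ⊢
  field_simp
  rw [hq]
  ring

/-- The balance behind the exponent of τ: the cap on E divided by the gain per boost has the same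
order d^{(p-2)/(3p-2)} as the number of progress steps in `inv_stepSize_mul`. -/
theorem tau_rpow {p : ℝ} (hp : 2 ≤ p) (hd : (0 : ℝ) < d) :
    tau d p ^ (2 / p) * (d : ℝ) ^ ((p - 2) / (3 * p - 2)) = 1600 * (d : ℝ) ^ (1 - 2 / p) := by
  have h3 : 3 * p - 2 ≠ 0 := by linarith
  have hp0 : 0 < p := by linarith
  rw [tau, Real.mul_rpow (by positivity) (by positivity), ← Real.rpow_mul (by norm_num),
    ← Real.rpow_mul hd.le, mul_assoc, ← Real.rpow_add hd]
  congr 1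
  · rw [show p * (2 / p) = 2 by field_simp]; norm_num
  · congr 1
    obtain ⟨q, hq⟩ : ∃ q, q = 3 * p - 2 := ⟨_, rfl⟩
    rw [← hq] at h3 ⊢
    field_simp
    rw [hq]
    ring

/-- Increase of `∑ s_i^p` allowed in one progress step. -/
def growthRate (d : ℕ) (p : ℝ) : ℝ :=
  9 / 2 * p * stepSize d p * ((8 * p) ^ (p - 1) * (d : ℝ) ^ (1 - 1 / p)) +
    ((p + 1) * stepSize d p) ^ p * tau d p

theorem mul_growthRate_le {p t : ℝ} (hp : 2 ≤ p) (hd : (1 : ℝ) ≤ d)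
    (ht : t * stepSize d p ≤ (d : ℝ) ^ (1 / p)) :
    t * growthRate d p ≤ (9 / 16 * (8 * p) ^ p + 5 * p) * d := by
  have hd0 : (0 : ℝ) < d := by linarith
  have hp0 : 0 < p := by linarith
  have h3 : 3 * p - 2 ≠ 0 := by linarith
  have hα := stepSize_pos hp0 hd0
  have h1 : t * (9 / 2 * p * stepSize d p * ((8 * p) ^ (p - 1) * (d : ℝ) ^ (1 - 1 / p))) ≤
      9 / 16 * (8 * p) ^ p * d := by
    calc _ = t * stepSize d p * (9 / 2 * p * ((8 * p) ^ (p - 1) * (d : ℝ) ^ (1 - 1 / p))) := by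
          ring
      _ ≤ (d : ℝ) ^ (1 / p) * (9 / 2 * p * ((8 * p) ^ (p - 1) * (d : ℝ) ^ (1 - 1 / p))) := by
          gcongr
      _ = 9 / 2 * p * (8 * p) ^ (p - 1) * ((d : ℝ) ^ (1 / p) * (d : ℝ) ^ (1 - 1 / p)) := by ring
      _ = _ := by
          rw [← Real.rpow_add hd0, add_sub_cancel, Real.rpow_one,
            Real.rpow_sub_one (by positivity)]
          field_simp; norm_num
  have h2 : t * (((p + 1) * stepSize d p) ^ p * tau d p) ≤ 5 * p * d := by
    have e1 : (p + 1) ^ p ≤ 3 * p ^ p := by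
      have := one_add_inv_rpow_le hp0
      rw [show 1 + 1 / p = (p + 1) / p by field_simp, Real.div_rpow (by positivity) hp0.le,
        div_le_iff₀ (by positivity)] at this
      exact this
    have e2 : (25 : ℝ) ^ (2 : ℝ) ≤ 25 ^ p := by gcongr; norm_num
    norm_num at e2
    -- The exponents of α and τ are chosen so that this product is exactly linear in d; with e4 the
    -- constant is 3 · 1000p/25^p ≤ 4.8p.
    have e3 : stepSize d p ^ (p - 1) * tau d p * (d : ℝ) ^ (1 / p) =
        (1000 * p) ^ (1 - p) * 40 ^ p * d := by
      rw [stepSize, tau, Real.mul_rpow (by positivity) (by positivity), one_div (1000 * p),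
        Real.inv_rpow (by positivity), ← Real.rpow_neg (by positivity), ← Real.rpow_mul hd0.le]
      rw [show ∀ a b c e f : ℝ, a * b * (c * e) * f = a * c * (b * e * f) by intros; ring,
        ← Real.rpow_add hd0, ← Real.rpow_add hd0, neg_sub]
      congr 1
      conv_rhs => rw [← Real.rpow_one (d : ℝ)]
      congr 1
      obtain ⟨q, hq⟩ : ∃ q, q = 3 * p - 2 := ⟨_, rfl⟩
      rw [← hq] at h3 ⊢
      field_simp
      rw [hq]
      ring
    have e4 : p ^ p * ((1000 * p) ^ (1 - p) * 40 ^ p) = 1000 * p / 25 ^ p := by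
      have e1000 : (1000 : ℝ) ^ p = 25 ^ p * 40 ^ p := by
        rw [← Real.mul_rpow (by norm_num) (by norm_num)]; norm_num
      rw [Real.rpow_sub (by positivity), Real.rpow_one, Real.mul_rpow (by norm_num) hp0.le, e1000]
      field_simp
    have eα : stepSize d p ^ p = stepSize d p * stepSize d p ^ (p - 1) := by
      rw [Real.rpow_sub_one hα.ne']; field_simp
    have hτ : 0 ≤ tau d p := by unfold tau; positivity
    rw [Real.mul_rpow (by positivity) hα.le, eα]
    calc _ = t * stepSize d p * ((p + 1) ^ p * stepSize d p ^ (p - 1) * tau d p) := by ring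
      _ ≤ (d : ℝ) ^ (1 / p) * (3 * p ^ p * stepSize d p ^ (p - 1) * tau d p) := by gcongr
      _ = 3 * p ^ p * (stepSize d p ^ (p - 1) * tau d p * (d : ℝ) ^ (1 / p)) := by ring
      _ = 3 * (p ^ p * ((1000 * p) ^ (1 - p) * 40 ^ p)) * d := by rw [e3]; ring
      _ ≤ 5 * p * d := by
          refine mul_le_mul_of_nonneg_right ?_ hd0.le
          rw [e4, ← mul_div_assoc, div_le_iff₀ (by positivity)]
          nlinarith
  unfold growthRate
  rw [mul_add]
  linarith

/-! ### Invariants of the main loop -/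

/-- Invariant of `s` after `t` progress steps and any number of boosting steps. -/
structure LoopInvariant (A : Matrix (Fin n) (Fin d) ℝ) (g : Fin d → ℝ) (r : Fin n → ℝ) (p : ℝ)
    (w : Fin n → ℝ) (t : ℕ) (s : Fin n → ℝ) : Prop where
  le : ∀ i, w i ^ (1 / p) ≤ s i
  sum_le : ∑ i, s i ^ p ≤ 2 * d + t * growthRate d p +
    kappa d p ^ 2 / 2 * minEnergy A g r p s

namespace OracleInput

variable {A : Matrix (Fin n) (Fin d) ℝ} {g : Fin d → ℝ} {r : Fin n → ℝ} {p : ℝ}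
  {w s s' : Fin n → ℝ} {t : ℕ}

theorem pos_of_le (H : OracleInput A g r p w) (hs : ∀ i, w i ^ (1 / p) ≤ s i) (i : Fin n) :
    0 < s i :=
  (Real.rpow_pos_of_pos (H.lewis.pos i) _).trans_le (hs i)

theorem mul_stepSize_le (H : OracleInput A g r p w) (ht : t ≤ numSteps d p) :
    t * stepSize d p ≤ (d : ℝ) ^ (1 / p) := by
  have hα := stepSize_pos H.p_pos (zero_lt_one.trans_le H.one_le_d)
  have h1 : (t : ℝ) ≤ (stepSize d p)⁻¹ * (d : ℝ) ^ (1 / p) :=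
    (Nat.cast_le.2 ht).trans (Nat.floor_le (by positivity))
  calc t * stepSize d p ≤ (stepSize d p)⁻¹ * (d : ℝ) ^ (1 / p) * stepSize d p := by gcongr
    _ = _ := by field_simp

/-- If Φ exceeded M = (8p)^p d, then κ² Φ^{1-2/p} ≤ Φ/64, since Φ^{2/p} ≥ 64 κ². The invariant then
gives Φ ≤ 9/16 M + 4p² d + Φ/128 with 4p² d ≤ M/16, a contradiction. No bound on E is assumed
beforehand. -/
theorem sum_rpow_le_of_invariant (H : OracleInput A g r p w) (ht : t ≤ numSteps d p)
    (h : LoopInvariant A g r p w t s) : ∑ i, s i ^ p ≤ (8 * p) ^ p * d := by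
  have hs := H.pos_of_le h.le
  have hp := H.two_le
  have hp0 := H.p_pos
  have hd := H.one_le_d
  have hd0 : (0 : ℝ) < d := by linarith
  set Φ := ∑ i, s i ^ p with hΦ
  by_contra! hlt
  have hM : (0 : ℝ) < (8 * p) ^ p * d := by positivity
  have hΦ0 : 0 < Φ := hM.trans hlt
  have h1 := h.sum_le
  have h2 := mul_growthRate_le hp hd (H.mul_stepSize_le ht)
  have h3 := H.minEnergy_le hs
  have hκ : kappa d p ^ 2 = p ^ 2 * (d : ℝ) ^ (2 / p) := by
    rw [kappa, mul_pow, ← Real.rpow_natCast ((d : ℝ) ^ (1 / p)), ← Real.rpow_mul hd0.le]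
    congr 2
    push_cast; ring
  have h4 : kappa d p ^ 2 * Φ ^ (1 - 2 / p) ≤ Φ / 64 := by
    have h5 : 64 * (p ^ 2 * (d : ℝ) ^ (2 / p)) ≤ Φ ^ (2 / p) := by
      calc 64 * (p ^ 2 * (d : ℝ) ^ (2 / p)) = ((8 * p) ^ p * d) ^ (2 / p) := by
            rw [Real.mul_rpow (by positivity) hd0.le, ← Real.rpow_mul (by positivity),
              show p * (2 / p) = 2 by field_simp, Real.rpow_two]
            ring
        _ ≤ _ := by gcongr
    rw [Real.rpow_sub hΦ0, Real.rpow_one, hκ, mul_div_assoc', div_le_iff₀ (by positivity)]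
    nlinarith
  have h5 : kappa d p ^ 2 * (d : ℝ) ^ (1 - 2 / p) = p ^ 2 * d := by
    rw [hκ, mul_assoc, ← Real.rpow_add hd0]; norm_num
  have h6 : 64 * p ^ 2 ≤ (8 * p) ^ p := by
    calc 64 * p ^ 2 = (8 * p) ^ (2 : ℝ) := by rw [Real.rpow_two]; ring
      _ ≤ _ := Real.rpow_le_rpow_of_exponent_le (by linarith) hp
  have h7 : 64 * p ^ 2 * d ≤ (8 * p) ^ p * d := by gcongr
  have h8 := mul_le_mul_of_nonneg_left h3 (show 0 ≤ kappa d p ^ 2 / 2 by positivity)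
  have h9 : (2 + 5 * p) * d ≤ 3.5 * p ^ 2 * d := by
    gcongr; nlinarith
  nlinarith

theorem minEnergy_le_of_invariant (H : OracleInput A g r p w) (ht : t ≤ numSteps d p)
    (h : LoopInvariant A g r p w t s) :
    minEnergy A g r p s ≤ 2 * (8 * p) ^ (p - 2) * (d : ℝ) ^ (1 - 2 / p) :=
  H.minEnergy_le_of_sum_le (H.pos_of_le h.le) (H.sum_rpow_le_of_invariant ht h)

theorem invariant_boost (H : OracleInput A g r p w) (ht : t ≤ numSteps d p)
    (h : LoopInvariant A g r p w t s)
    (hτ : tau d p ≤ lpNorm p (A *ᵥ (quadMin A g r p s).1) ^ p)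
    (hs' : s' = boost A p s (quadMin A g r p s).1) :
    LoopInvariant A g r p w t s' ∧ (∀ i, s i ≤ s' i) ∧
      minEnergy A g r p s + tau d p ^ (2 / p) / 10 ≤ minEnergy A g r p s' := by
  have hp : 2 < p := H.two_le.lt_of_ne fun e =>
    (H.sum_lt_tau_of_eq_two (H.pos_of_le h.le) e.symm).not_ge hτ
  obtain ⟨h1, h2, h3⟩ := H.boost_spec hp h.le (H.sum_rpow_le_of_invariant ht h) hτ hs'
  exact ⟨⟨fun i => (h.le i).trans (h1 i), by linarith [h.sum_le]⟩, h1, h2⟩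

theorem invariant_progress (H : OracleInput A g r p w) (ht : t ≤ numSteps d p)
    (h : LoopInvariant A g r p w t s)
    (hτ : lpNorm p (A *ᵥ (quadMin A g r p s).1) ^ p < tau d p)
    (hs' : s' = fun i => s i + stepSize d p * |(A *ᵥ (quadMin A g r p s).1) i|) :
    LoopInvariant A g r p w (t + 1) s' ∧ minEnergy A g r p s ≤ minEnergy A g r p s' := by
  have hs := H.pos_of_le h.le
  have hp := H.two_le
  have hp0 := H.p_pos
  have hd0 : (0 : ℝ) < d := zero_lt_one.trans_le H.one_le_d
  have hα := stepSize_pos hp0 hd0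
  set α := stepSize d p with hαdef
  set z := (quadMin A g r p s).1 with hz
  have hle : ∀ i, s i ≤ s' i := fun i => by
    rw [hs']; have : 0 ≤ α * |(A *ᵥ z) i| := by positivity
    linarith
  have hE := H.minEnergy_mono hs hle
  refine ⟨⟨fun i => (h.le i).trans (hle i), ?_⟩, hE⟩
  have hΦ := H.sum_rpow_le_of_invariant ht h
  set X := (8 * p) ^ (p - 1) * (d : ℝ) ^ (1 - 1 / p) with hX
  have hX0 : 0 ≤ X := by positivity
  -- Cauchy–Schwarz with s^{p-1} |Az| = s^{p/2} · s^{p/2-1} |Az| bounds the square by Φ E ≤ 2X², and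
  -- √2 ≤ 3/2.
  have hCS : ∑ i, |(A *ᵥ z) i| * s i ^ (p - 1) ≤ 3 / 2 * X := by
    refine abs_le_of_sq_le_sq' ?_ (by positivity) |>.2
    have h1 := Finset.sum_mul_sq_le_sq_mul_sq Finset.univ (fun i => s i ^ (p / 2))
      (fun i => s i ^ (p / 2 - 1) * |(A *ᵥ z) i|)
    have e1 : ∀ i, s i ^ (p / 2) * (s i ^ (p / 2 - 1) * |(A *ᵥ z) i|) =
        |(A *ᵥ z) i| * s i ^ (p - 1) := fun i => by
      rw [← mul_assoc, ← Real.rpow_add (hs i), mul_comm]; congr 2; ring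
    have e2 : ∀ i, (s i ^ (p / 2)) ^ 2 = s i ^ p := fun i => by
      rw [← Real.rpow_natCast, ← Real.rpow_mul (hs i).le]; congr 1; push_cast; ring
    have e3 : ∀ i, (s i ^ (p / 2 - 1) * |(A *ᵥ z) i|) ^ 2 = s i ^ (p - 2) * (A *ᵥ z) i ^ 2 :=
      fun i => by
        rw [mul_pow, sq_abs, ← Real.rpow_natCast, ← Real.rpow_mul (hs i).le]
        congr 2; push_cast; ring
    simp only [e1, e2, e3] at h1
    have h2 : ∑ i, s i ^ (p - 2) * (A *ᵥ z) i ^ 2 ≤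
        2 * (8 * p) ^ (p - 2) * (d : ℝ) ^ (1 - 2 / p) :=
      H.sum_le_minEnergy.trans (H.minEnergy_le_of_invariant ht h)
    have h3 : (8 * p) ^ p * d * (2 * (8 * p) ^ (p - 2) * (d : ℝ) ^ (1 - 2 / p)) = 2 * X ^ 2 := by
      have e4 : (8 * p) ^ p * (8 * p) ^ (p - 2) = ((8 * p) ^ (p - 1)) ^ 2 := by
        rw [← Real.rpow_natCast ((8 * p) ^ (p - 1)), ← Real.rpow_mul (by positivity),
          ← Real.rpow_add (by positivity)]
        congr 1; push_cast; ring
      have e5 : d * (d : ℝ) ^ (1 - 2 / p) = ((d : ℝ) ^ (1 - 1 / p)) ^ 2 := by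
        rw [← Real.rpow_natCast ((d : ℝ) ^ (1 - 1 / p)), ← Real.rpow_mul hd0.le]
        conv_lhs => rw [← Real.rpow_one (d : ℝ)]
        rw [Real.rpow_one, ← Real.rpow_one_add' hd0.le (by
          have : 2 / p ≤ 1 := (div_le_one hp0).2 hp
          linarith)]
        congr 1; push_cast; ring
      rw [hX, mul_pow, ← e4, ← e5]; ring
    have h4 : (∑ i, s i ^ p) * ∑ i, s i ^ (p - 2) * (A *ᵥ z) i ^ 2 ≤ 2 * X ^ 2 := by
      rw [← h3]
      exact mul_le_mul hΦ h2 (Finset.sum_nonneg fun i _ =>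
        mul_nonneg (Real.rpow_nonneg (hs i).le _) (sq_nonneg _)) (by positivity)
    nlinarith
  have hsum : ∑ i, s' i ^ p ≤ ∑ i, s i ^ p +
      3 * p * α * (∑ i, |(A *ᵥ z) i| * s i ^ (p - 1)) +
        ((p + 1) * α) ^ p * ∑ i, |(A *ᵥ z) i| ^ p := by
    rw [Finset.mul_sum, Finset.mul_sum, ← Finset.sum_add_distrib, ← Finset.sum_add_distrib]
    refine Finset.sum_le_sum fun i _ => ?_
    have h1 := add_rpow_le_progress (show 1 ≤ p by linarith) (hs i)
      (show 0 ≤ α * |(A *ᵥ z) i| by positivity)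
    rw [← mul_assoc (p + 1), Real.mul_rpow (x := (p + 1) * α) (by positivity)
      (abs_nonneg _)] at h1
    rw [hs']
    linarith
  rw [← lpNorm_rpow hp0] at hsum
  have h1 : 3 * p * α * (∑ i, |(A *ᵥ z) i| * s i ^ (p - 1)) ≤ 3 * p * α * (3 / 2 * X) := by
    gcongr
  have h2 : ((p + 1) * α) ^ p * lpNorm p (A *ᵥ z) ^ p ≤ ((p + 1) * α) ^ p * tau d p := by
    gcongr
  have h3 : growthRate d p = 9 / 2 * p * α * X + ((p + 1) * α) ^ p * tau d p := rfl
  have h4 := mul_le_mul_of_nonneg_left hE (show 0 ≤ kappa d p ^ 2 / 2 by positivity)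
  have := h.sum_le
  push_cast
  linarith

theorem rpow_tau_pos (H : OracleInput A g r p w) : 0 < tau d p ^ (2 / p) :=
  Real.rpow_pos_of_pos H.tau_pos _

/-- Termination: m counts how many boost gains fit between the current E and its cap, which holds
after every boost. -/
theorem exists_whileRuns (H : OracleInput A g r p w) (ht : t ≤ numSteps d p) (m : ℕ) :
    ∀ s, LoopInvariant A g r p w t s →
      2 * (8 * p) ^ (p - 2) * (d : ℝ) ^ (1 - 2 / p) - minEnergy A g r p s ≤
        m * (tau d p ^ (2 / p) / 10) →
      ∃ s₁ M, WhileRuns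
          (fun a : (Fin n → ℝ) × (Fin d → ℝ) => tau d p ≤ lpNorm p (A *ᵥ a.2) ^ p)
          (boostBody A g r p) (s, (quadMin A g r p s).1) (s₁, (quadMin A g r p s₁).1) M ∧
        LoopInvariant A g r p w t s₁ ∧ (∀ i, s i ≤ s₁ i) ∧
        lpNorm p (A *ᵥ (quadMin A g r p s₁).1) ^ p < tau d p ∧
        minEnergy A g r p s + M * (tau d p ^ (2 / p) / 10) ≤ minEnergy A g r p s₁ := by
  have hgap := H.rpow_tau_pos
  induction m with
  | zero =>
    intro s hs hm
    by_cases hc : tau d p ≤ lpNorm p (A *ᵥ (quadMin A g r p s).1) ^ p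
    -- With no headroom left, one more boost would push E above its cap.
    · obtain ⟨h1, h1', h2⟩ := H.invariant_boost ht hs hc rfl
      have h3 := H.minEnergy_le_of_invariant ht h1
      rw [Nat.cast_zero, zero_mul] at hm
      linarith
    · exact ⟨s, 0, .done hc, hs, fun i => le_rfl, not_le.1 hc, by simp⟩
  | succ m ih =>
    intro s hs hm
    by_cases hc : tau d p ≤ lpNorm p (A *ᵥ (quadMin A g r p s).1) ^ p
    · obtain ⟨h1, h1', h2⟩ := H.invariant_boost ht hs hc rfl
      obtain ⟨s₁, M, h3, h4, h4', h5, h6⟩ := ih _ h1 (by push_cast at hm; linarith)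
      refine ⟨s₁, 1 + M, .next hc h3, h4, fun i => (h1' i).trans (h4' i), h5, ?_⟩
      push_cast
      linarith
    · exact ⟨s, 0, .done hc, hs, fun i => le_rfl, not_le.1 hc, by simp⟩

theorem invariant_init (H : OracleInput A g r p w) :
    LoopInvariant A g r p w 0 fun i => w i ^ (1 / p) := by
  refine ⟨fun i => le_rfl, ?_⟩
  have h1 : ∑ i, (w i ^ (1 / p)) ^ p = ∑ i, w i := Finset.sum_congr rfl fun i _ => by
    rw [← Real.rpow_mul (H.lewis.pos i).le, one_div, inv_mul_cancel₀ H.p_pos.ne', Real.rpow_one]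
  have h2 := H.minEnergy_nonneg (s := fun i => w i ^ (1 / p)) (H.pos_of_le fun i => le_rfl)
  have h3 : 0 ≤ kappa d p ^ 2 / 2 * minEnergy A g r p (fun i => w i ^ (1 / p)) := by positivity
  rw [h1, Nat.cast_zero, zero_mul]
  linarith [H.lewis.sum_le]

end OracleInput

/-! ### Quality of the output and total number of solves -/

/-- The triangle inequality for the square root of the energy; the cross term is bounded by
Cauchy–Schwarz. -/
theorem energy_add_smul_le {A : Matrix (Fin n) (Fin d) ℝ} {ρ : Fin n → ℝ} (h0 : ∀ i, 0 ≤ ρ i)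
    {y z : Fin d → ℝ} {a b B : ℝ} (ha : 0 ≤ a) (hb : 0 ≤ b) (hB : 0 ≤ B)
    (hy : energy A ρ y ≤ a ^ 2 * B) (hz : energy A ρ z ≤ B) :
    energy A ρ (y + b • z) ≤ (a + b) ^ 2 * B := by
  have hexp : energy A ρ (y + b • z) = energy A ρ y +
      2 * b * (∑ i, ρ i * (A *ᵥ y) i * (A *ᵥ z) i) + b ^ 2 * energy A ρ z := by
    simp only [energy, Finset.mul_sum, ← Finset.sum_add_distrib]
    refine Finset.sum_congr rfl fun i _ => ?_
    rw [mulVec_add, mulVec_smul]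
    simp only [Pi.add_apply, Pi.smul_apply, smul_eq_mul]
    ring
  have hCS : ∑ i, ρ i * (A *ᵥ y) i * (A *ᵥ z) i ≤ a * B := by
    refine abs_le_of_sq_le_sq' ?_ (by positivity) |>.2
    have h1 := Finset.sum_mul_sq_le_sq_mul_sq Finset.univ (fun i => √(ρ i) * (A *ᵥ y) i)
      (fun i => √(ρ i) * (A *ᵥ z) i)
    have e1 : ∀ i, √(ρ i) * (A *ᵥ y) i * (√(ρ i) * (A *ᵥ z) i) =
        ρ i * (A *ᵥ y) i * (A *ᵥ z) i := fun i => by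
      rw [mul_mul_mul_comm, Real.mul_self_sqrt (h0 i), mul_assoc]
    simp only [e1, mul_pow, Real.sq_sqrt (h0 _)] at h1
    refine h1.trans ?_
    calc _ ≤ (a ^ 2 * B) * B :=
          mul_le_mul hy hz (energy_nonneg h0 z) (by positivity)
      _ = _ := by ring
  rw [hexp]
  have h1 := mul_le_mul_of_nonneg_left hCS (show 0 ≤ 2 * b by positivity)
  have h2 := mul_le_mul_of_nonneg_left hz (sq_nonneg b)
  nlinarith

namespace OracleInput

variable {A : Matrix (Fin n) (Fin d) ℝ} {g : Fin d → ℝ} {r : Fin n → ℝ} {p : ℝ}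
  {w s s' : Fin n → ℝ} {t : ℕ}

/-- The last clause is an amortized count: each round has one unconditional solve, and each boost is
paid for by an increase of E, which no step decreases. -/
theorem exists_oracleRuns (H : OracleInput A g r p w) (ht : t ≤ numSteps d p) :
    ∃ y s N, OracleRuns A g r p w t y s N ∧ LoopInvariant A g r p w t s ∧
      (∀ i, |(A *ᵥ y) i| ≤ s i) ∧ g ⬝ᵥ y = -(t * stepSize d p) ∧
      energy A r y ≤ (t * stepSize d p) ^ 2 * (2 * (8 * p) ^ (p - 2)) ∧
      N * (tau d p ^ (2 / p) / 10) ≤ t * (tau d p ^ (2 / p) / 10) + minEnergy A g r p s := by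
  have hp0 := H.p_pos
  have hd0 : (0 : ℝ) < d := zero_lt_one.trans_le H.one_le_d
  have hα := stepSize_pos hp0 hd0
  induction t with
  | zero =>
    refine ⟨0, _, 0, .init, H.invariant_init, fun i => ?_, by simp, by simp [energy], ?_⟩
    · simp only [mulVec_zero, Pi.zero_apply, abs_zero]
      exact Real.rpow_nonneg (H.lewis.pos i).le _
    · have := H.minEnergy_nonneg (s := fun i => w i ^ (1 / p)) (H.pos_of_le fun i => le_rfl)
      simpa using this
  | succ t ih =>
    obtain ⟨y, s, N, h1, h2, h3, h4, h5, h6⟩ := ih (by omega)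
    have ht' : t ≤ numSteps d p := by omega
    have hgap := H.rpow_tau_pos
    obtain ⟨m, hm⟩ := exists_nat_ge
      ((2 * (8 * p) ^ (p - 2) * (d : ℝ) ^ (1 - 2 / p) - minEnergy A g r p s) /
        (tau d p ^ (2 / p) / 10))
    rw [div_le_iff₀ (by positivity)] at hm
    obtain ⟨s₁, M, k1, k2, hss, k3, k4⟩ := H.exists_whileRuns ht' m s h2 hm
    obtain ⟨l1, l2⟩ := H.invariant_progress ht' k2 k3 rfl
    have hs₁ := H.pos_of_le k2.le
    set z := (quadMin A g r p s₁).1 with hz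
    refine ⟨_, _, _, .round h1 k1, l1, fun i => ?_, ?_, ?_, ?_⟩
    · rw [mulVec_add, mulVec_smul]
      simp only [Pi.add_apply, Pi.smul_apply, smul_eq_mul]
      calc _ ≤ |(A *ᵥ y) i| + |stepSize d p * (A *ᵥ z) i| := abs_add_le _ _
        _ ≤ s₁ i + stepSize d p * |(A *ᵥ z) i| := by
            rw [abs_mul, abs_of_pos hα]
            linarith [h3 i, hss i]
    · rw [dotProduct_add, dotProduct_smul, h4, H.dotProduct_quadMin hs₁]
      simp only [smul_eq_mul]; push_cast; ring
    · have hEz : energy A r z ≤ 2 * (8 * p) ^ (p - 2) := by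
        have h7 := (energy_r_le (A := A) (g := g) (r := r) hs₁).trans
          (H.minEnergy_le_of_invariant ht' k2)
        have : 0 < (d : ℝ) ^ (1 - 2 / p) := by positivity
        exact le_of_mul_le_mul_left (by linarith) this
      refine (energy_add_smul_le H.residual.1 (by positivity) hα.le (by positivity) h5
        hEz).trans (le_of_eq ?_)
      push_cast; ring
    · have h7 : (quadMin A g r p s).2 = 1 := rfl
      rw [h7]
      push_cast
      linarith

/-- The main loop terminates with an approximate solution after few solves. -/
theorem exists_oracleReturns (H : OracleInput A g r p w) :
    ∃ y N, OracleReturns A g r p w y N ∧ IsApproxSolution A g r p ((1000 * p) ^ p) y ∧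
      (N : ℝ) ≤ (1000 * p) ^ p * (d : ℝ) ^ ((p - 2) / (3 * p - 2)) := by
  have hp := H.two_le
  have hp0 := H.p_pos
  have hd := H.one_le_d
  have hd0 : (0 : ℝ) < d := zero_lt_one.trans_le hd
  have hα := stepSize_pos hp0 hd0
  have hgap := H.rpow_tau_pos
  obtain ⟨y, s, N, h1, h2, h3, h4, h5, h6⟩ := H.exists_oracleRuns le_rfl
  have hs := H.pos_of_le h2.le
  set D := (d : ℝ) ^ ((p - 2) / (3 * p - 2)) with hD
  have hD1 : 1 ≤ D := Real.one_le_rpow hd (div_nonneg (by linarith) (by linarith))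
  have hx : (stepSize d p)⁻¹ * (d : ℝ) ^ (1 / p) = 1000 * p * D := inv_stepSize_mul hp hd0
  have hTle : (numSteps d p : ℝ) ≤ 1000 * p * D := by
    rw [← hx]; exact Nat.floor_le (by positivity)
  -- The floor loses less than 1, which is at most half of 1000 p D because D ≥ 1.
  have hTge : 1000 * p * D / 2 ≤ numSteps d p := by
    have : 1000 * p * D < numSteps d p + 1 := by rw [← hx]; exact Nat.lt_floor_add_one _
    nlinarith
  set m := stepSize d p * (numSteps d p : ℝ) with hm
  have hm2 : (d : ℝ) ^ (1 / p) / 2 ≤ m := by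
    calc (d : ℝ) ^ (1 / p) / 2 = stepSize d p * (1000 * p * D / 2) := by
          rw [← hx]; field_simp
      _ ≤ m := by rw [hm]; gcongr
  have hm0 : 0 < m := lt_of_lt_of_le (by positivity) hm2
  rw [mul_comm (numSteps d p : ℝ), ← hm] at h4 h5
  have h1000 : (1 : ℝ) ≤ 1000 * p := by linarith
  refine ⟨m⁻¹ • y, N, ⟨y, s, h1, rfl⟩, ⟨?_, ?_, ?_⟩, ?_⟩
  · rw [dotProduct_smul, h4, smul_eq_mul]
    field_simp
  · rw [dotProduct_mulVec_gram_self]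
    have e : energy A r (m⁻¹ • y) = energy A r y / m ^ 2 := by
      simp only [energy, Finset.sum_div]
      refine Finset.sum_congr rfl fun i _ => ?_
      rw [mulVec_smul]
      simp only [Pi.smul_apply, smul_eq_mul]
      field_simp
    rw [e, div_le_iff₀ (by positivity)]
    have e1 : (8 * p) ^ (p - 2) = (8 * p) ^ p / (8 * p) ^ 2 := by
      rw [Real.rpow_sub (by positivity), Real.rpow_two]
    have e2 : 2 * (8 * p) ^ (p - 2) ≤ (1000 * p) ^ p := by
      calc 2 * (8 * p) ^ (p - 2) ≤ (8 * p) ^ p := by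
            rw [e1, ← mul_div_assoc, div_le_iff₀ (by positivity), mul_comm]
            gcongr; nlinarith
        _ ≤ _ := by gcongr; norm_num
    nlinarith [mul_le_mul_of_nonneg_right e2 (sq_nonneg m)]
  · have hΦ := H.sum_rpow_le_of_invariant le_rfl h2
    have hsum : ∑ i, |(A *ᵥ (m⁻¹ • y)) i| ^ p ≤ (16 * p) ^ p := by
      calc ∑ i, |(A *ᵥ (m⁻¹ • y)) i| ^ p ≤ ∑ i, (m⁻¹) ^ p * s i ^ p := by
            refine Finset.sum_le_sum fun i _ => ?_
            rw [mulVec_smul, Pi.smul_apply, smul_eq_mul, abs_mul, abs_of_pos (inv_pos.2 hm0),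
              Real.mul_rpow (by positivity) (abs_nonneg _)]
            gcongr
            exact h3 i
        _ ≤ (m⁻¹) ^ p * ((8 * p) ^ p * d) := by rw [← Finset.mul_sum]; gcongr
        _ ≤ (((d : ℝ) ^ (1 / p) / 2)⁻¹) ^ p * ((8 * p) ^ p * d) := by gcongr
        _ = (16 * p) ^ p := by
            rw [inv_div, Real.div_rpow (by norm_num) (by positivity), ← Real.rpow_mul hd0.le,
              one_div, inv_mul_cancel₀ hp0.ne', Real.rpow_one,
              show (16 : ℝ) * p = 2 * (8 * p) by ring, Real.mul_rpow (x := 2) (by norm_num)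
                (by positivity)]
            field_simp
    calc lpNorm p (A *ᵥ (m⁻¹ • y)) ≤ ((16 * p) ^ p) ^ (1 / p) := by
          unfold lpNorm
          exact Real.rpow_le_rpow (Finset.sum_nonneg fun i _ => by positivity) hsum
            (by positivity)
      _ = 16 * p := by
          rw [← Real.rpow_mul (by positivity), mul_one_div_cancel hp0.ne', Real.rpow_one]
      _ ≤ 1000 * p := by linarith
      _ = (1000 * p) ^ (1 : ℝ) := (Real.rpow_one _).symm
      _ ≤ (1000 * p) ^ p := Real.rpow_le_rpow_of_exponent_le h1000 (by linarith)
  · have hE := H.minEnergy_le_of_invariant le_rfl h2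
    have hτD := tau_rpow hp hd0
    rw [← hD] at hτD
    have h7 : (N : ℝ) * (tau d p ^ (2 / p) / 10) ≤
        (numSteps d p + (8 * p) ^ (p - 2) * D) * (tau d p ^ (2 / p) / 10) := by
      have e : (8 * p) ^ (p - 2) * D * (tau d p ^ (2 / p) / 10) =
          160 * (8 * p) ^ (p - 2) * (d : ℝ) ^ (1 - 2 / p) := by
        linear_combination (8 * p) ^ (p - 2) / 10 * hτD
      have : 0 ≤ (8 * p) ^ (p - 2) * (d : ℝ) ^ (1 - 2 / p) := by positivity
      rw [add_mul, e]
      linarith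
    have h8 : (N : ℝ) ≤ (1000 * p + (8 * p) ^ (p - 2)) * D := by
      have := le_of_mul_le_mul_right h7 (by positivity)
      linarith
    refine h8.trans (mul_le_mul_of_nonneg_right ?_ (by positivity))
    have e1 : (1000 * p) ^ p = (1000 * p) ^ (p - 2) * (1000 * p) ^ 2 := by
      rw [← Real.rpow_two, ← Real.rpow_add (by positivity)]; congr 1; ring
    have e2 : (8 * p) ^ (p - 2) ≤ (1000 * p) ^ (p - 2) := by
      apply Real.rpow_le_rpow (by positivity) (by linarith) (by linarith)
    have e3 : 1 ≤ (1000 * p) ^ (p - 2) := Real.one_le_rpow h1000 (by linarith)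
    have e4 : 1000 * p + 1 ≤ (1000 * p) ^ 2 := by nlinarith
    rw [e1]
    have := mul_le_mul_of_nonneg_left e4 (zero_le_one.trans e3)
    nlinarith

end OracleInput

/-! ### Leverage scores -/

/-- The vector `B (Bᵀ B)⁻¹ b_i` for `B = diag v A`, where `b_i` is row `i` of `B`. -/
def leverageVec (A : Matrix (Fin n) (Fin d) ℝ) (v : Fin n → ℝ) (i : Fin n) : Fin n → ℝ :=
  (diagonal v * A) *ᵥ ((Aᵀ * diagonal (fun j => v j ^ 2) * A)⁻¹ *ᵥ (diagonal v * A) i)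

/-- The leverage score of row `i` of `diag v A`. -/
def leverage (A : Matrix (Fin n) (Fin d) ℝ) (v : Fin n → ℝ) (i : Fin n) : ℝ :=
  ∑ l, leverageVec A v i l ^ 2

section Leverage

variable {A : Matrix (Fin n) (Fin d) ℝ} {v : Fin n → ℝ}

theorem transpose_mul_diagonal_mul (A : Matrix (Fin n) (Fin d) ℝ) (v : Fin n → ℝ) :
    (diagonal v * A)ᵀ * (diagonal v * A) = Aᵀ * diagonal (fun j => v j ^ 2) * A := by
  rw [transpose_mul, diagonal_transpose, Matrix.mul_assoc, ← Matrix.mul_assoc (diagonal v),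
    diagonal_mul_diagonal, Matrix.mul_assoc]
  simp only [sq]

theorem transpose_inv_gram (A : Matrix (Fin n) (Fin d) ℝ) (ρ : Fin n → ℝ) :
    ((Aᵀ * diagonal ρ * A)⁻¹)ᵀ = (Aᵀ * diagonal ρ * A)⁻¹ := by
  rw [transpose_nonsing_inv]
  congr 1
  simp [Matrix.mul_assoc]

/-- The sketch of `leverageVec` that `approxLev` computes. -/
theorem mulVec_inv_mulVec_transpose (A : Matrix (Fin n) (Fin d) ℝ) (v q : Fin n → ℝ)
    (i : Fin n) :
    ((diagonal v * A) *ᵥ ((Aᵀ * diagonal (fun j => v j ^ 2) * A)⁻¹ *ᵥ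
      ((diagonal v * A)ᵀ *ᵥ q))) i = q ⬝ᵥ leverageVec A v i := by
  rw [leverageVec, dotProduct_mulVec, ← mulVec_transpose (diagonal v * A) q, dotProduct_mulVec,
    ← mulVec_transpose, transpose_inv_gram, dotProduct_comm]
  rfl

theorem leverage_nonneg (A : Matrix (Fin n) (Fin d) ℝ) (v : Fin n → ℝ) (i : Fin n) :
    0 ≤ leverage A v i :=
  Finset.sum_nonneg fun _ _ => sq_nonneg _

/-- The vectors `leverageVec` are the columns of the orthogonal projection onto the range of B, so
they reproduce the coordinates of every Bx. -/
theorem dotProduct_leverageVec (hM : (Aᵀ * diagonal (fun j => v j ^ 2) * A).PosDef)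
    (x : Fin d → ℝ) (i : Fin n) :
    ((diagonal v * A) *ᵥ x) ⬝ᵥ leverageVec A v i = ((diagonal v * A) *ᵥ x) i := by
  rw [← mulVec_inv_mulVec_transpose, mulVec_mulVec (M := (diagonal v * A)ᵀ),
    transpose_mul_diagonal_mul, mulVec_mulVec (N := Aᵀ * _ * A),
    nonsing_inv_mul _ ((isUnit_iff_isUnit_det _).1 hM.isUnit), one_mulVec]

/-- The projection P is symmetric and idempotent, so P_ii = ∑ P_il². -/
theorem leverageVec_self (hM : (Aᵀ * diagonal (fun j => v j ^ 2) * A).PosDef) (i : Fin n) :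
    leverageVec A v i i = leverage A v i := by
  have h := dotProduct_leverageVec hM
    ((Aᵀ * diagonal (fun j => v j ^ 2) * A)⁻¹ *ᵥ (diagonal v * A) i) i
  change leverageVec A v i ⬝ᵥ leverageVec A v i = leverageVec A v i i at h
  rw [← h, leverage, dotProduct]
  exact Finset.sum_congr rfl fun l _ => sq _ |>.symm

theorem leverage_le_one (hM : (Aᵀ * diagonal (fun j => v j ^ 2) * A).PosDef) (i : Fin n) :
    leverage A v i ≤ 1 := by
  have h : leverage A v i ^ 2 ≤ leverage A v i := by
    calc leverage A v i ^ 2 = leverageVec A v i i ^ 2 := by rw [leverageVec_self hM]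
      _ ≤ leverage A v i := Finset.single_le_sum (f := fun l => leverageVec A v i l ^ 2)
          (fun l _ => sq_nonneg _) (Finset.mem_univ i)
  nlinarith

theorem sum_leverage (hM : (Aᵀ * diagonal (fun j => v j ^ 2) * A).PosDef) :
    ∑ i, leverage A v i = d := by
  set B := diagonal v * A with hB
  set M := Aᵀ * diagonal (fun j => v j ^ 2) * A with hMdef
  have h1 : ∀ i, leverage A v i = (B * M⁻¹ * Bᵀ) i i := fun i => by
    rw [← leverageVec_self hM, leverageVec, ← hB, ← hMdef, mulVec_mulVec]
    rfl
  calc ∑ i, leverage A v i = (B * M⁻¹ * Bᵀ).trace := Finset.sum_congr rfl fun i _ => h1 i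
    _ = (Bᵀ * B * M⁻¹).trace := by rw [trace_mul_comm, ← Matrix.mul_assoc]
    _ = d := by
      rw [hB, transpose_mul_diagonal_mul, ← hMdef,
        mul_nonsing_inv _ ((isUnit_iff_isUnit_det _).1 hM.isUnit), trace_one, Fintype.card_fin]

/-- Cauchy–Schwarz applied to the reproducing identity. -/
theorem sq_mul_sq_le_leverage (hM : (Aᵀ * diagonal (fun j => v j ^ 2) * A).PosDef)
    (x : Fin d → ℝ) (i : Fin n) :
    v i ^ 2 * (A *ᵥ x) i ^ 2 ≤ leverage A v i * energy A (fun j => v j ^ 2) x := by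
  have hBx : ∀ j, ((diagonal v * A) *ᵥ x) j = v j * (A *ᵥ x) j := fun j => by
    rw [← mulVec_mulVec, mulVec_diagonal]
  have h := Finset.sum_mul_sq_le_sq_mul_sq Finset.univ ((diagonal v * A) *ᵥ x)
    (leverageVec A v i)
  have h2 := dotProduct_leverageVec hM x i
  rw [dotProduct] at h2
  rw [h2] at h
  simp only [hBx, mul_pow] at h
  rw [mul_comm (leverage A v i)]
  exact h

end Leverage

/-! ### Averages of approximate fixed point iterates -/

/-- `W` is a run of the weight iteration in which all estimates of the first `T` rounds are
correct up to a factor `1 ± 1/10`. -/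
structure IsAccurateRun (A : Matrix (Fin n) (Fin d) ℝ) (p : ℝ) (T : ℕ) (W : ℕ → Fin n → ℝ) :
    Prop where
  zero : W 0 = fun _ => (d : ℝ) / n
  lower : ∀ k < T, ∀ i,
    9 / 10 * leverage A (fun j => W k j ^ (1 / 2 - 1 / p : ℝ)) i ≤ W (k + 1) i
  upper : ∀ k < T, ∀ i,
    W (k + 1) i ≤ 11 / 10 * leverage A (fun j => W k j ^ (1 / 2 - 1 / p : ℝ)) i

namespace IsAccurateRun

variable {A : Matrix (Fin n) (Fin d) ℝ} {p : ℝ} {T : ℕ} {W : ℕ → Fin n → ℝ}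

theorem nonneg (h : IsAccurateRun A p T W) {k : ℕ} (hk : k ≤ T) (i : Fin n) : 0 ≤ W k i := by
  cases k with
  | zero => rw [h.zero]; positivity
  | succ k => exact (mul_nonneg (by norm_num) (leverage_nonneg A _ i)).trans (h.lower k hk i)

theorem rpow_sq (h : IsAccurateRun A p T W) {k : ℕ} (hk : k ≤ T) (i : Fin n) :
    (W k i ^ (1 / 2 - 1 / p : ℝ)) ^ 2 = W k i ^ (1 - 2 / p) := by
  rw [← Real.rpow_natCast, ← Real.rpow_mul (h.nonneg hk i)]
  congr 1; push_cast; ring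

theorem posDef_of_pos (hA : Function.Injective A.mulVec) {w : Fin n → ℝ}
    (hpos : ∀ i x, (A *ᵥ x) i ≠ 0 → 0 < w i) (e : ℝ) :
    (Aᵀ * diagonal (fun j => (w j ^ e) ^ 2) * A).PosDef := by
  refine posDef_gram hA (fun i => sq_nonneg _) fun i hi x => ?_
  by_contra hx
  have := Real.rpow_pos_of_pos (hpos i x hx) e
  exact (pow_pos this 2).ne' hi

/-- A zero row of A has leverage 0, so iterates can vanish there. Elsewhere positivity propagates,
and this is enough for the Gram matrices to stay invertible. -/
theorem pos (h : IsAccurateRun A p T W) (hA : Function.Injective A.mulVec) (hn : 0 < n)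
    (hd : 0 < d) {k : ℕ} (hk : k ≤ T) (i : Fin n) (x : Fin d → ℝ) (hx : (A *ᵥ x) i ≠ 0) :
    0 < W k i := by
  induction k generalizing i x with
  | zero => rw [h.zero]; positivity
  | succ k ih =>
    have hk' : k ≤ T := by omega
    have hM := posDef_of_pos hA (ih hk') (1 / 2 - 1 / p)
    refine lt_of_lt_of_le (mul_pos (by norm_num) ?_) (h.lower k hk i)
    refine (leverage_nonneg A _ i).lt_of_ne fun h0 => ?_
    have h1 := sq_mul_sq_le_leverage hM x i
    rw [← h0, zero_mul] at h1
    have h2 := Real.rpow_pos_of_pos (ih hk' i x hx) (1 / 2 - 1 / p)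
    have : 0 < (W k i ^ (1 / 2 - 1 / p : ℝ)) ^ 2 * (A *ᵥ x) i ^ 2 := by positivity
    linarith

theorem posDef (h : IsAccurateRun A p T W) (hA : Function.Injective A.mulVec) (hn : 0 < n)
    (hd : 0 < d) {k : ℕ} (hk : k ≤ T) :
    (Aᵀ * diagonal (fun j => (W k j ^ (1 / 2 - 1 / p : ℝ)) ^ 2) * A).PosDef :=
  posDef_of_pos hA (h.pos hA hn hd hk) _

theorem le_eleven_tenths (h : IsAccurateRun A p T W) (hA : Function.Injective A.mulVec)
    (hn : 0 < n) (hd : 0 < d) {k : ℕ} (hk : k < T) (i : Fin n) : W (k + 1) i ≤ 11 / 10 := by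
  have := h.upper k hk i
  have := leverage_le_one (h.posDef hA hn hd hk.le) i
  linarith

theorem sum_le (h : IsAccurateRun A p T W) (hA : Function.Injective A.mulVec) (hn : 0 < n)
    (hd : 0 < d) {k : ℕ} (hk : k ≤ T) : ∑ i, W k i ≤ 11 / 10 * d := by
  cases k with
  | zero =>
    rw [h.zero]
    have : (0 : ℝ) < n := by exact_mod_cast hn
    simp only [Finset.sum_const, Finset.card_univ, Fintype.card_fin, nsmul_eq_mul]
    rw [mul_div_cancel₀ _ this.ne']
    have : (0 : ℝ) ≤ d := by positivity
    linarith
  | succ k =>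
    rw [← sum_leverage (h.posDef hA hn hd (show k ≤ T by omega)), Finset.mul_sum]
    exact Finset.sum_le_sum fun i _ => h.upper k hk i

/-- Each round gives (9/10)(Ax)_i² W_k^{1-2/p}/W_{k+1} ≤ Q_k. Averaging over k, the right side is at
most Q by concavity, and the left ratio is at least e^{-0.12} V^{-2/p} by Jensen and telescoping.
The factor 3/2 absorbs the loss, and the mass stays at most 3/2 · 11/10 · d ≤ 2d. -/
theorem isLewisOverestimate (h : IsAccurateRun A p T W) (hA : Function.Injective A.mulVec)
    (hp : 2 ≤ p) (hn : 2 ≤ n) (hd : 0 < d) (hT : 10 * Real.log n ≤ T) :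
    IsLewisOverestimate A p ((3 / (2 * (T : ℝ))) • ∑ k ∈ Finset.range T, W k) := by
  have hp0 : 0 < p := by linarith
  have hn0 : 0 < n := by omega
  have hn' : (0 : ℝ) < n := by positivity
  have hd' : (1 : ℝ) ≤ d := by exact_mod_cast hd
  have hlog : 0.69 ≤ Real.log n := by
    have h1 : Real.log 2 ≤ Real.log n := Real.log_le_log (by norm_num) (by exact_mod_cast hn)
    linarith [Real.log_two_gt_d9]
  have hT0 : (0 : ℝ) < T := by linarith
  have hT0' : 0 < T := by exact_mod_cast hT0
  have hkT : ∀ k ∈ Finset.range T, k ≤ T := fun k hk => (Finset.mem_range.1 hk).le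
  set V : Fin n → ℝ := fun i => ∑ k ∈ Finset.range T, (1 / (T : ℝ)) * W k i with hV
  have hw : ∀ i, ((3 / (2 * (T : ℝ))) • ∑ k ∈ Finset.range T, W k) i = 3 / 2 * V i := fun i => by
    simp only [hV, Pi.smul_apply, Finset.sum_apply, smul_eq_mul, ← Finset.mul_sum]
    field_simp
  have hone : ∑ _k ∈ Finset.range T, 1 / (T : ℝ) = 1 := by
    rw [Finset.sum_const, Finset.card_range, nsmul_eq_mul]; field_simp
  have hT1 : ∀ k ∈ Finset.range T, 0 ≤ 1 / (T : ℝ) := fun _ _ => by positivity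
  have hVpos : ∀ i, 0 < V i := fun i => by
    refine Finset.sum_pos' (fun k hk => mul_nonneg (hT1 k hk) (h.nonneg (hkT k hk) i))
      ⟨0, Finset.mem_range.2 hT0', ?_⟩
    rw [h.zero]; positivity
  refine ⟨fun i => by rw [hw]; linarith [hVpos i], ?_, fun x i => ?_⟩
  · have h1 : ∑ i, V i ≤ 11 / 10 * d := by
      rw [hV, Finset.sum_comm]
      calc _ ≤ ∑ k ∈ Finset.range T, 1 / (T : ℝ) * (11 / 10 * d) := by
            refine Finset.sum_le_sum fun k hk => ?_
            rw [← Finset.mul_sum]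
            exact mul_le_mul_of_nonneg_left (h.sum_le hA hn0 hd (hkT k hk)) (hT1 k hk)
        _ = _ := by rw [← Finset.sum_mul, hone, one_mul]
    simp only [hw, ← Finset.mul_sum]
    linarith
  · simp only [hw]
    set Q := energy A (fun j => V j ^ (1 - 2 / p)) x with hQ
    have hscale : energy A (fun j => (3 / 2 * V j) ^ (1 - 2 / p)) x =
        (3 / 2) ^ (1 - 2 / p) * Q := by
      simp only [hQ, energy, Finset.mul_sum]
      refine Finset.sum_congr rfl fun j _ => ?_
      rw [Real.mul_rpow (by norm_num) (hVpos j).le]; ring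
    have hrhs : (3 / 2 * V i) ^ (2 / p) * energy A (fun j => (3 / 2 * V j) ^ (1 - 2 / p)) x =
        3 / 2 * (V i ^ (2 / p) * Q) := by
      rw [hscale, Real.mul_rpow (by norm_num) (hVpos i).le]
      have : (3 / 2 : ℝ) ^ (2 / p) * (3 / 2) ^ (1 - 2 / p) = 3 / 2 := by
        rw [← Real.rpow_add (by norm_num)]; norm_num
      linear_combination (V i ^ (2 / p) * Q) * this
    rw [hrhs]
    have hQ0 : 0 ≤ Q := energy_nonneg (fun j => Real.rpow_nonneg (hVpos j).le _) x
    rcases eq_or_ne ((A *ᵥ x) i) 0 with h0 | h0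
    · rw [h0]
      have := mul_nonneg (Real.rpow_nonneg (hVpos i).le (2 / p)) hQ0
      linarith
    have hWpos : ∀ k ≤ T, 0 < W k i := fun k hk => h.pos hA hn0 hd hk i x h0
    -- the energies of the iterates average to at most that of the averaged weights
    have hconc : ∑ k ∈ Finset.range T, 1 / (T : ℝ) * energy A (fun j => W k j ^ (1 - 2 / p)) x ≤
        Q := by
      simp only [hQ, energy, Finset.mul_sum]
      rw [Finset.sum_comm]
      refine Finset.sum_le_sum fun j _ => ?_
      have h1 := (Real.concaveOn_rpow (p := 1 - 2 / p)
        (by rw [sub_nonneg, div_le_one hp0]; exact hp)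
        (by have : 0 < 2 / p := by positivity
            linarith)).le_map_sum (t := Finset.range T)
        (w := fun _ => 1 / (T : ℝ)) (p := fun k => W k j) hT1 hone
        (fun k hk => h.nonneg (hkT k hk) j)
      simp only [smul_eq_mul] at h1
      calc _ = (∑ k ∈ Finset.range T, 1 / (T : ℝ) * W k j ^ (1 - 2 / p)) * (A *ᵥ x) j ^ 2 := by
            rw [Finset.sum_mul]; exact Finset.sum_congr rfl fun k _ => by ring
        _ ≤ _ := mul_le_mul_of_nonneg_right h1 (sq_nonneg _)
    have hlev : ∀ k ∈ Finset.range T, 9 / 10 * (A *ᵥ x) i ^ 2 *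
        Real.exp ((1 - 2 / p) * Real.log (W k i) - Real.log (W (k + 1) i)) ≤
          energy A (fun j => W k j ^ (1 - 2 / p)) x := fun k hk => by
      have hk' := Finset.mem_range.1 hk
      have h1 := sq_mul_sq_le_leverage (h.posDef hA hn0 hd hk'.le) x i
      simp only [h.rpow_sq hk'.le] at h1
      have h2 := h.lower k hk' i
      have hE : 0 ≤ energy A (fun j => W k j ^ (1 - 2 / p)) x :=
        energy_nonneg (fun j => Real.rpow_nonneg (h.nonneg hk'.le j) _) x
      have hW1 := hWpos (k + 1) hk'
      rw [Real.exp_sub, Real.exp_log hW1, mul_comm (1 - 2 / p),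
        ← Real.rpow_def_of_pos (hWpos k hk'.le), mul_div_assoc', div_le_iff₀ hW1]
      nlinarith
    have hexp : Real.exp (-0.12) * V i ^ (-(2 / p)) ≤ ∑ k ∈ Finset.range T, 1 / (T : ℝ) *
        Real.exp ((1 - 2 / p) * Real.log (W k i) - Real.log (W (k + 1) i)) := by
      have h1 := convexOn_exp.map_sum_le (t := Finset.range T) (w := fun _ => 1 / (T : ℝ))
        (p := fun k => (1 - 2 / p) * Real.log (W k i) - Real.log (W (k + 1) i)) hT1 hone
        (fun k _ => Set.mem_univ _)
      simp only [smul_eq_mul] at h1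
      refine le_trans ?_ h1
      rw [Real.rpow_def_of_pos (hVpos i), ← Real.exp_add, Real.exp_le_exp]
      have h2 : ∑ k ∈ Finset.range T, 1 / (T : ℝ) * Real.log (W k i) ≤ Real.log (V i) := by
        have := strictConcaveOn_log_Ioi.concaveOn.le_map_sum (t := Finset.range T)
          (w := fun _ => 1 / (T : ℝ)) (p := fun k => W k i) hT1 hone
          (fun k hk => hWpos k (hkT k hk))
        simpa only [smul_eq_mul] using this
      have h3 : ∑ k ∈ Finset.range T, 1 / (T : ℝ) *
          ((1 - 2 / p) * Real.log (W k i) - Real.log (W (k + 1) i)) =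
          1 / (T : ℝ) * (Real.log (W 0 i) - Real.log (W T i)) -
            2 / p * ∑ k ∈ Finset.range T, 1 / (T : ℝ) * Real.log (W k i) := by
        rw [← Finset.sum_range_sub' (fun k => Real.log (W k i)), Finset.mul_sum, Finset.mul_sum,
          ← Finset.sum_sub_distrib]
        exact Finset.sum_congr rfl fun k _ => by ring
      -- W_0 ≥ 1/n and W_T ≤ 11/10, so the average is at least -(log n + 0.1)/T; use T ≥ 10 log n ≥
      -- 6.9.
      have h4 : -0.12 ≤ 1 / (T : ℝ) * (Real.log (W 0 i) - Real.log (W T i)) := by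
        have h5 : Real.log (W T i) ≤ 0.1 := by
          obtain ⟨m, rfl⟩ : ∃ m, T = m + 1 := ⟨T - 1, by omega⟩
          have := h.le_eleven_tenths hA hn0 hd (Nat.lt_succ_self m) i
          linarith [Real.log_le_sub_one_of_pos (hWpos (m + 1) le_rfl)]
        have h6 : -Real.log n ≤ Real.log (W 0 i) := by
          rw [h.zero, Real.log_div (by positivity) hn'.ne']
          linarith [Real.log_nonneg hd']
        rw [one_div, inv_mul_eq_div, le_div_iff₀ hT0]
        linarith
      have h7 : 0 ≤ 2 / p := by positivity
      rw [h3]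
      nlinarith [mul_le_mul_of_nonneg_left h2 h7]
    have h1 : 9 / 10 * (A *ᵥ x) i ^ 2 * (Real.exp (-0.12) * V i ^ (-(2 / p))) ≤ Q := by
      refine le_trans (mul_le_mul_of_nonneg_left hexp (by positivity)) (le_trans ?_ hconc)
      rw [Finset.mul_sum]
      refine Finset.sum_le_sum fun k hk => ?_
      have := mul_le_mul_of_nonneg_left (hlev k hk) (hT1 k hk)
      linarith
    have h2 : 0.88 ≤ Real.exp (-0.12) := by linarith [Real.add_one_le_exp (-0.12)]
    have hVp : 0 < V i ^ (2 / p) := Real.rpow_pos_of_pos (hVpos i) _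
    rw [Real.rpow_neg (hVpos i).le] at h1
    have h3 : 9 / 10 * (A *ᵥ x) i ^ 2 * Real.exp (-0.12) ≤ V i ^ (2 / p) * Q := by
      calc _ = V i ^ (2 / p) *
            (9 / 10 * (A *ᵥ x) i ^ 2 * (Real.exp (-0.12) * (V i ^ (2 / p))⁻¹)) := by
            field_simp
        _ ≤ _ := by gcongr
    nlinarith [sq_nonneg ((A *ᵥ x) i)]

end IsAccurateRun

/-! ### Random signs -/

/-- The sign combination `∑ ± u_l`. -/
def signSum (u : Fin n → ℝ) (b : Fin n → Bool) : ℝ := ∑ l, signOf (b l) * u l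

theorem sum_signs_succ (f : (Fin (n + 1) → Bool) → ℝ) :
    ∑ b, f b = ∑ b : Fin n → Bool, (f (Fin.cons true b) + f (Fin.cons false b)) := by
  rw [← (Fin.consEquiv fun _ => Bool).sum_comp, Fintype.sum_prod_type, Fintype.sum_bool,
    ← Finset.sum_add_distrib]
  rfl

theorem signSum_cons (u : Fin (n + 1) → ℝ) (c : Bool) (b : Fin n → Bool) :
    signSum u (Fin.cons c b) = signOf c * u 0 + signSum (fun l => u l.succ) b := by
  simp [signSum, Fin.sum_univ_succ]

theorem sum_signSum_sq (u : Fin n → ℝ) :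
    ∑ b, signSum u b ^ 2 = 2 ^ n * ∑ l, u l ^ 2 := by
  induction n with
  | zero => simp [signSum]
  | succ n ih =>
    rw [sum_signs_succ, Fin.sum_univ_succ, pow_succ, mul_add, mul_assoc _ _ (∑ l, _),
      mul_left_comm, ← ih, Finset.mul_sum]
    have : (2 : ℝ) ^ n * 2 * u 0 ^ 2 = ∑ _b : Fin n → Bool, 2 * u 0 ^ 2 := by
      simp [mul_assoc]
    rw [this, ← Finset.sum_add_distrib]
    refine Finset.sum_congr rfl fun b _ => ?_
    rw [signSum_cons, signSum_cons]
    simp only [signOf]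
    norm_num
    ring

theorem sum_signSum_pow_four_le (u : Fin n → ℝ) :
    ∑ b, signSum u b ^ 4 ≤ 2 ^ n * (3 * (∑ l, u l ^ 2) ^ 2) := by
  induction n with
  | zero => simp [signSum]
  | succ n ih =>
    have h1 := ih (fun l => u l.succ)
    have h2 := sum_signSum_sq (fun l => u l.succ)
    have h3 : ∑ b, signSum u b ^ 4 = 2 * ∑ b, signSum (fun l => u l.succ) b ^ 4 +
        12 * u 0 ^ 2 * (∑ b, signSum (fun l => u l.succ) b ^ 2) + 2 ^ n * (2 * u 0 ^ 4) := by
      have : (2 : ℝ) ^ n * (2 * u 0 ^ 4) = ∑ _b : Fin n → Bool, 2 * u 0 ^ 4 := by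
        simp
      rw [sum_signs_succ, this, Finset.mul_sum, Finset.mul_sum, ← Finset.sum_add_distrib,
        ← Finset.sum_add_distrib]
      refine Finset.sum_congr rfl fun b _ => ?_
      rw [signSum_cons, signSum_cons]
      simp only [signOf]
      norm_num
      ring
    rw [h3, h2, Fin.sum_univ_succ]
    have h4 : (0 : ℝ) ≤ 2 ^ n * u 0 ^ 4 := by positivity
    have h5 : 2 ^ (n + 1) * (3 * (u 0 ^ 2 + ∑ l : Fin n, u l.succ ^ 2) ^ 2) =
        2 * (2 ^ n * (3 * (∑ l : Fin n, u l.succ ^ 2) ^ 2)) +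
          12 * u 0 ^ 2 * (2 ^ n * ∑ l : Fin n, u l.succ ^ 2) + 6 * (2 ^ n * u 0 ^ 4) := by
      ring
    linarith

/-- Sub-Gaussian bound: the exponential moment factors over coordinates into cosh(t u_l) ≤ exp(t²
u_l²/2). -/
theorem sum_exp_signSum_le (u : Fin n → ℝ) (t : ℝ) :
    ∑ b, Real.exp (t * signSum u b) ≤ 2 ^ n * Real.exp (t ^ 2 * (∑ l, u l ^ 2) / 2) := by
  induction n with
  | zero => simp [signSum]
  | succ n ih =>
    have h1 : ∑ b, Real.exp (t * signSum u b) =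
        2 * Real.cosh (t * u 0) * ∑ b, Real.exp (t * signSum (fun l => u l.succ) b) := by
      rw [sum_signs_succ, Finset.mul_sum]
      refine Finset.sum_congr rfl fun b _ => ?_
      rw [signSum_cons, signSum_cons, Real.cosh_eq, mul_add, mul_add, Real.exp_add, Real.exp_add]
      simp only [signOf]
      norm_num
      ring
    rw [h1, Fin.sum_univ_succ]
    calc _ ≤ 2 * Real.exp ((t * u 0) ^ 2 / 2) *
          (2 ^ n * Real.exp (t ^ 2 * (∑ l : Fin n, u l.succ ^ 2) / 2)) := by
          gcongr
          · exact Real.cosh_le_exp_half_sq _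
          · exact ih _
      _ = 2 ^ (n + 1) * (Real.exp ((t * u 0) ^ 2 / 2) *
            Real.exp (t ^ 2 * (∑ l : Fin n, u l.succ ^ 2) / 2)) := by ring
      _ = _ := by
          rw [← Real.exp_add]; congr 2; ring

/-- Completing the square writes exp(c²) as a Gaussian average of exponentials linear in c, which
linearizes the square of a sign sum. -/
theorem integral_exp_neg_sq_add (c : ℝ) :
    ∫ y : ℝ, Real.exp (-y ^ 2 + 2 * c * y) = Real.exp (c ^ 2) * √Real.pi := by
  have h1 : ∀ y : ℝ, Real.exp (-y ^ 2 + 2 * c * y) =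
      Real.exp (c ^ 2) * Real.exp (-1 * (y - c) ^ 2) := fun y => by
    rw [← Real.exp_add]; congr 1; ring
  simp only [h1]
  rw [MeasureTheory.integral_const_mul,
    MeasureTheory.integral_sub_right_eq_self (fun y => Real.exp (-1 * y ^ 2)), integral_gaussian]
  simp

theorem integrable_exp_neg_sq_add (c : ℝ) :
    MeasureTheory.Integrable fun y : ℝ => Real.exp (-y ^ 2 + 2 * c * y) := by
  have h1 : ∀ y : ℝ, Real.exp (-y ^ 2 + 2 * c * y) =
      Real.exp (c ^ 2) * Real.exp (-1 * (y - c) ^ 2) := fun y => by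
    rw [← Real.exp_add]; congr 1; ring
  simp only [h1]
  exact ((integrable_exp_neg_mul_sq one_pos).comp_sub_right c).const_mul _

/-- The exponential moment of the square of a sign combination of a unit vector. -/
theorem sum_exp_mul_signSum_sq_le {u : Fin n → ℝ} (hu : ∑ l, u l ^ 2 = 1) :
    ∑ b, Real.exp (1 / 40 * signSum u b ^ 2) ≤ 2 ^ n * Real.exp (11 / 400 - 1 / 800) := by
  -- Chernoff parameter 1/40: the upper threshold is 1/40 · 11/10 = 11/400, and 1/800 is the margin
  -- per sketch row.
  set c : ℝ := √(1 / 40) with hc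
  have hc2 : c ^ 2 = 1 / 40 := Real.sq_sqrt (by norm_num)
  have hpi : 0 < √Real.pi := Real.sqrt_pos.2 Real.pi_pos
  have h1 : (∑ b, Real.exp (1 / 40 * signSum u b ^ 2)) * √Real.pi =
      ∫ y : ℝ, ∑ b, Real.exp (-y ^ 2 + 2 * (c * signSum u b) * y) := by
    rw [MeasureTheory.integral_finsetSum _ fun b _ => integrable_exp_neg_sq_add _, Finset.sum_mul]
    refine Finset.sum_congr rfl fun b _ => ?_
    rw [integral_exp_neg_sq_add, mul_pow, hc2]
  have h2 : ∀ y : ℝ, ∑ b, Real.exp (-y ^ 2 + 2 * (c * signSum u b) * y) ≤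
      2 ^ n * Real.exp (-(19 / 20) * y ^ 2) := fun y => by
    have h3 := sum_exp_signSum_le u (2 * c * y)
    rw [hu] at h3
    calc _ = Real.exp (-y ^ 2) * ∑ b, Real.exp (2 * c * y * signSum u b) := by
          rw [Finset.mul_sum]
          refine Finset.sum_congr rfl fun b _ => ?_
          rw [← Real.exp_add]; congr 1; ring
      _ ≤ Real.exp (-y ^ 2) * (2 ^ n * Real.exp ((2 * c * y) ^ 2 * 1 / 2)) := by gcongr
      _ = _ := by
          rw [mul_left_comm, ← Real.exp_add]
          congr 2
          rw [mul_pow, mul_pow, hc2]; ring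
  have h3 : (∑ b, Real.exp (1 / 40 * signSum u b ^ 2)) * √Real.pi ≤
      2 ^ n * √(Real.pi / (19 / 20)) := by
    rw [h1, ← integral_gaussian, ← MeasureTheory.integral_const_mul]
    exact MeasureTheory.integral_mono
      (MeasureTheory.integrable_finsetSum _ fun b _ => integrable_exp_neg_sq_add _)
      ((integrable_exp_neg_mul_sq (by norm_num)).const_mul _) h2
  -- The Gaussian integral leaves (1 - 2/40)^{-1/2}, so the claim reduces to 20/19 ≤ exp(0.0525).
  have h4 : √(Real.pi / (19 / 20)) ≤ Real.exp (11 / 400 - 1 / 800) * √Real.pi := by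
    apply Real.sqrt_le_iff.2
    refine ⟨by positivity, ?_⟩
    rw [mul_pow, Real.sq_sqrt Real.pi_pos.le, ← Real.exp_nat_mul, div_eq_mul_inv, mul_comm]
    gcongr
    have := Real.quadratic_le_exp_of_nonneg (show (0 : ℝ) ≤ (2 : ℕ) * (11 / 400 - 1 / 800) by
      norm_num)
    refine le_trans ?_ this
    norm_num
  have h5 : (∑ b, Real.exp (1 / 40 * signSum u b ^ 2)) * √Real.pi ≤
      2 ^ n * Real.exp (11 / 400 - 1 / 800) * √Real.pi := by
    rw [mul_assoc]
    exact h3.trans (by gcongr)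
  exact le_of_mul_le_mul_right h5 hpi

/-- The lower tail needs only second and fourth moments, through exp(-x) ≤ 1 - x + x²/2. With
parameter 1/30 the threshold is -(1/30)(9/10) = -3/100, again with margin 1/800. -/
theorem sum_exp_neg_mul_signSum_sq_le {u : Fin n → ℝ} (hu : ∑ l, u l ^ 2 = 1) :
    ∑ b, Real.exp (-(1 / 30) * signSum u b ^ 2) ≤ 2 ^ n * Real.exp (-(3 / 100) - 1 / 800) := by
  have hexp : ∀ x : ℝ, 0 ≤ x → Real.exp (-x) ≤ 1 - x + x ^ 2 / 2 := fun x hx => by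
    have h1 := Real.quadratic_le_exp_of_nonneg hx
    rw [Real.exp_neg, inv_le_iff_one_le_mul₀ (Real.exp_pos x)]
    have h2 : 0 ≤ 1 - x + x ^ 2 / 2 := by nlinarith [sq_nonneg (x - 1)]
    nlinarith [mul_le_mul_of_nonneg_left h1 h2, sq_nonneg (x ^ 2)]
  have h1 : ∑ b, Real.exp (-(1 / 30) * signSum u b ^ 2) ≤
      ∑ b, (1 - 1 / 30 * signSum u b ^ 2 + 1 / 1800 * signSum u b ^ 4) := by
    refine Finset.sum_le_sum fun b _ => ?_
    have := hexp (1 / 30 * signSum u b ^ 2) (by positivity)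
    rw [neg_mul]
    refine this.trans (le_of_eq (by ring))
  rw [Finset.sum_add_distrib, Finset.sum_sub_distrib, ← Finset.mul_sum, ← Finset.mul_sum,
    sum_signSum_sq] at h1
  have h2 := sum_signSum_pow_four_le u
  rw [hu] at h1 h2
  have h3 : ∑ _b : Fin n → Bool, (1 : ℝ) = 2 ^ n := by simp
  rw [h3] at h1
  have h4 := Real.add_one_le_exp (-(3 / 100) - 1 / 800 : ℝ)
  have h5 : (0 : ℝ) < 2 ^ n := by positivity
  nlinarith

/-- Markov's inequality for the sum of `k` independent copies. -/
theorem card_filter_le_of_sum_exp_le {k : ℕ} {f : (Fin n → Bool) → ℝ} {a c : ℝ}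
    (h : ∑ b, Real.exp (f b) ≤ 2 ^ n * Real.exp (a - c)) :
    ((Finset.univ.filter fun ω : Fin k → Fin n → Bool => k * a ≤ ∑ j, f (ω j)).card : ℝ) ≤
      Fintype.card (Fin k → Fin n → Bool) * Real.exp (-(k * c)) := by
  have h1 : ∑ ω : Fin k → Fin n → Bool, Real.exp (∑ j, f (ω j)) =
      (∑ b, Real.exp (f b)) ^ k := by
    rw [Fintype.sum_pow]
    exact Finset.sum_congr rfl fun ω _ => Real.exp_sum _ _
  have h2 : ((Finset.univ.filter fun ω : Fin k → Fin n → Bool => k * a ≤ ∑ j, f (ω j)).card : ℝ) *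
      Real.exp (k * a) ≤ ∑ ω : Fin k → Fin n → Bool, Real.exp (∑ j, f (ω j)) := by
    rw [← nsmul_eq_mul]
    refine (Finset.card_nsmul_le_sum _ _ _ fun ω hω => ?_).trans
      (Finset.sum_le_sum_of_subset_of_nonneg (Finset.filter_subset _ _)
        fun _ _ _ => (Real.exp_pos _).le)
    exact Real.exp_le_exp.2 (Finset.mem_filter.1 hω).2
  have h3 : (∑ b, Real.exp (f b)) ^ k ≤ (2 ^ n * Real.exp (a - c)) ^ k :=
    pow_le_pow_left₀ (Finset.sum_nonneg fun _ _ => (Real.exp_pos _).le) h k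
  have h4 : ((2 : ℝ) ^ n * Real.exp (a - c)) ^ k =
      Fintype.card (Fin k → Fin n → Bool) * Real.exp (-(k * c)) * Real.exp (k * a) := by
    rw [mul_pow, ← Real.exp_nat_mul, mul_assoc, ← Real.exp_add]
    congr 1
    · simp
    · congr 1; ring
  rw [h1] at h2
  exact le_of_mul_le_mul_right (h2.trans (h3.trans h4.le)) (Real.exp_pos _)

/-- The random sign sketch of a vector has the right length up to a factor `1 ± 1/10`, but for a
fraction `2 exp (-k / 800)` of the sketches. -/
theorem card_inaccurate_le (k : ℕ) (u : Fin n → ℝ) :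
    ((Finset.univ.filter fun ω : Fin k → Fin n → Bool =>
      ¬ (k * (9 / 10 * ∑ l, u l ^ 2) ≤ ∑ j, signSum u (ω j) ^ 2 ∧
        ∑ j, signSum u (ω j) ^ 2 ≤ k * (11 / 10 * ∑ l, u l ^ 2))).card : ℝ) ≤
      Fintype.card (Fin k → Fin n → Bool) * (2 * Real.exp (-(k * (1 / 800)))) := by
  set s := ∑ l, u l ^ 2 with hs
  have hs0 : 0 ≤ s := Finset.sum_nonneg fun l _ => sq_nonneg _
  rcases hs0.eq_or_lt with h0 | h0
  · have hu : ∀ l, u l = 0 := fun l => by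
      have := (Finset.sum_eq_zero_iff_of_nonneg fun l _ => sq_nonneg (u l)).1 h0.symm l
        (Finset.mem_univ l)
      exact pow_eq_zero_iff two_ne_zero |>.1 this
    have hz : ∀ b, signSum u b = 0 := fun b => by simp [signSum, hu]
    simp only [hz, ← h0]
    simp
    positivity
  set v : Fin n → ℝ := fun l => u l / √s with hv
  have hsq : √s ^ 2 = s := Real.sq_sqrt hs0
  have hv1 : ∑ l, v l ^ 2 = 1 := by
    simp only [hv, div_pow, hsq, ← Finset.sum_div, ← hs]
    exact div_self h0.ne'
  have huv : ∀ b, signSum u b ^ 2 = s * signSum v b ^ 2 := fun b => by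
    have : signSum v b = signSum u b / √s := by
      simp only [signSum, hv, Finset.sum_div, mul_div_assoc]
    rw [this, div_pow, hsq]; field_simp
  have hup := card_filter_le_of_sum_exp_le (k := k) (sum_exp_mul_signSum_sq_le hv1)
  have hlow := card_filter_le_of_sum_exp_le (k := k) (sum_exp_neg_mul_signSum_sq_le hv1)
  have hsub : (Finset.univ.filter fun ω : Fin k → Fin n → Bool =>
      ¬ (k * (9 / 10 * s) ≤ ∑ j, signSum u (ω j) ^ 2 ∧
        ∑ j, signSum u (ω j) ^ 2 ≤ k * (11 / 10 * s))) ⊆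
      (Finset.univ.filter fun ω : Fin k → Fin n → Bool =>
        k * (11 / 400 : ℝ) ≤ ∑ j, 1 / 40 * signSum v (ω j) ^ 2) ∪
      (Finset.univ.filter fun ω : Fin k → Fin n → Bool =>
        k * (-(3 / 100) : ℝ) ≤ ∑ j, -(1 / 30) * signSum v (ω j) ^ 2) := by
    intro ω hω
    simp only [Finset.mem_filter, Finset.mem_univ, true_and, Finset.mem_union] at hω ⊢
    by_contra! hcon
    obtain ⟨h1, h2⟩ := hcon
    simp only [← Finset.mul_sum] at h1 h2
    apply hω
    simp only [huv, ← Finset.mul_sum]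
    constructor <;> nlinarith
  have h1 := (Nat.cast_le (α := ℝ)).2 ((Finset.card_le_card hsub).trans (Finset.card_union_le _ _))
  rw [Nat.cast_add] at h1
  linarith

/-! ### Success probability of the weight computation -/

theorem ofReal_le_toOuterMeasure_uniformOfFintype {α : Type*} [Fintype α] [Nonempty α]
    {P : α → Prop} [DecidablePred P] {δ : ℝ}
    (h : ((Finset.univ.filter fun a => ¬ P a).card : ℝ) ≤ Fintype.card α * δ) :
    ENNReal.ofReal (1 - δ) ≤ (PMF.uniformOfFintype α).toOuterMeasure {a | P a} := by
  rw [PMF.toOuterMeasure_uniformOfFintype_apply]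
  have hc : (0 : ℝ) < Fintype.card α := by exact_mod_cast Fintype.card_pos
  have h1 := Finset.card_filter_add_card_filter_not (s := (Finset.univ : Finset α)) P
  rw [Finset.card_univ] at h1
  have h2 : Fintype.card {a | P a} = (Finset.univ.filter P).card := by
    rw [← Fintype.card_subtype]; rfl
  rw [h2, ← ENNReal.ofReal_natCast, ← ENNReal.ofReal_natCast, ← ENNReal.ofReal_div_of_pos hc]
  apply ENNReal.ofReal_le_ofReal
  rw [le_div_iff₀ hc]
  have h3 : ((Finset.univ.filter P).card : ℝ) + (Finset.univ.filter fun a => ¬ P a).card =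
      Fintype.card α := by exact_mod_cast h1
  linarith

/-- One step of the chain rule, with e a uniform lower bound for the conditional success
probability. -/
theorem mul_le_toOuterMeasure_bind {α β : Type*} (q : PMF α) (f : α → PMF β) {G : Set α}
    {S : Set β} {e : ENNReal} (h : ∀ a ∈ G, e ≤ (f a).toOuterMeasure S) :
    q.toOuterMeasure G * e ≤ (q.bind f).toOuterMeasure S := by
  rw [PMF.toOuterMeasure_bind_apply, PMF.toOuterMeasure_apply, ← ENNReal.tsum_mul_right]
  refine ENNReal.tsum_le_tsum fun a => ?_
  by_cases ha : a ∈ G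
  · rw [Set.indicator_of_mem ha]
    exact mul_le_mul_right (h a ha) _
  · rw [Set.indicator_of_notMem ha, zero_mul]
    exact zero_le

/-- The number of rows of the sketches. -/
def sketchSize (c : ℝ) (n : ℕ) : ℕ := ⌈c * (1 / 10 : ℝ)⁻¹ ^ 2 * Real.log n⌉₊

/-- Union bound over the n rows: k ≥ 100 c log n turns each failure rate 2 exp(-k/800) into 2
n^{-c/8}. -/
theorem approxLev_accurate {c : ℝ} (hc : 0 < c) (hn : 2 ≤ n) (A : Matrix (Fin n) (Fin d) ℝ)
    (v : Fin n → ℝ) :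
    ENNReal.ofReal (1 - 2 * (n : ℝ) ^ (1 - c / 8)) ≤
      (approxLev c (1 / 10) A v).toOuterMeasure
        {x | (∀ i, 9 / 10 * leverage A v i ≤ x.1 i ∧ x.1 i ≤ 11 / 10 * leverage A v i) ∧
          x.2 = sketchSize c n} := by
  classical
  have hn0 : (0 : ℝ) < n := by positivity
  have hlog : 0 < Real.log n := Real.log_pos (by exact_mod_cast hn)
  have hkle : c * 100 * Real.log n ≤ sketchSize c n := by
    refine le_trans (le_of_eq ?_) (Nat.le_ceil _)
    norm_num
  unfold approxLev
  simp only
  rw [PMF.toOuterMeasure_map_apply]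
  change _ ≤ (PMF.uniformOfFintype (Fin (sketchSize c n) → Fin n → Bool)).toOuterMeasure _
  set k := sketchSize c n with hk
  have hk0 : (0 : ℝ) < k := lt_of_lt_of_le (by positivity) hkle
  have hexp : Real.exp (-(k * (1 / 800))) ≤ (n : ℝ) ^ (-(c / 8)) := by
    rw [Real.rpow_def_of_pos hn0, Real.exp_le_exp]
    linarith
  set P : (Fin k → Fin n → Bool) → Prop := fun ω => ∀ i,
    k * (9 / 10 * leverage A v i) ≤ ∑ j, signSum (leverageVec A v i) (ω j) ^ 2 ∧
      ∑ j, signSum (leverageVec A v i) (ω j) ^ 2 ≤ k * (11 / 10 * leverage A v i) with hP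
  have hcard : ((Finset.univ.filter fun ω => ¬ P ω).card : ℝ) ≤
      Fintype.card (Fin k → Fin n → Bool) * (2 * (n : ℝ) ^ (1 - c / 8)) := by
    have hsub : (Finset.univ.filter fun ω => ¬ P ω) ⊆ Finset.univ.biUnion fun i =>
        Finset.univ.filter fun ω : Fin k → Fin n → Bool =>
          ¬ (k * (9 / 10 * ∑ l, leverageVec A v i l ^ 2) ≤
              ∑ j, signSum (leverageVec A v i) (ω j) ^ 2 ∧
            ∑ j, signSum (leverageVec A v i) (ω j) ^ 2 ≤
              k * (11 / 10 * ∑ l, leverageVec A v i l ^ 2)) := by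
      intro ω hω
      simp only [hP, Finset.mem_filter, Finset.mem_univ, true_and, not_forall] at hω
      obtain ⟨i, hi⟩ := hω
      simp only [Finset.mem_biUnion, Finset.mem_univ, true_and, Finset.mem_filter]
      exact ⟨i, hi⟩
    have h1 := (Nat.cast_le (α := ℝ)).2 ((Finset.card_le_card hsub).trans Finset.card_biUnion_le)
    refine h1.trans ?_
    rw [Nat.cast_sum]
    refine (Finset.sum_le_sum fun i _ => card_inaccurate_le k (leverageVec A v i)).trans ?_
    rw [Finset.sum_const, Finset.card_univ, Fintype.card_fin, nsmul_eq_mul, mul_left_comm]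
    refine mul_le_mul_of_nonneg_left ?_ (Nat.cast_nonneg _)
    rw [sub_eq_add_neg, Real.rpow_add hn0, Real.rpow_one, mul_left_comm]
    gcongr
  refine (ofReal_le_toOuterMeasure_uniformOfFintype hcard).trans
    (MeasureTheory.OuterMeasure.mono _ fun ω hω => ?_)
  change P ω at hω
  refine ⟨fun i => ?_, ?_⟩
  · have h1 : ∀ j, ((diagonal v * A) *ᵥ (solve A (fun i => v i ^ 2)
        ((diagonal v * A)ᵀ *ᵥ fun i => signOf (ω j i) / √(k : ℝ))).1) i ^ 2 =
        signSum (leverageVec A v i) (ω j) ^ 2 / k := fun j => by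
      simp only [solve]
      rw [mulVec_inv_mulVec_transpose]
      have : (fun i => signOf (ω j i) / √(k : ℝ)) ⬝ᵥ leverageVec A v i =
          signSum (leverageVec A v i) (ω j) / √(k : ℝ) := by
        simp only [dotProduct, signSum, Finset.sum_div]
        exact Finset.sum_congr rfl fun l _ => by ring
      rw [this, div_pow, Real.sq_sqrt hk0.le]
    have h2 : ∑ j, ((diagonal v * A) *ᵥ (solve A (fun i => v i ^ 2)
        ((diagonal v * A)ᵀ *ᵥ fun i => signOf (ω j i) / √(k : ℝ))).1) i ^ 2 =
        (∑ j, signSum (leverageVec A v i) (ω j) ^ 2) / k := by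
      rw [Finset.sum_div]
      exact Finset.sum_congr rfl fun j _ => h1 j
    obtain ⟨h3, h4⟩ := hω i
    refine ⟨?_, ?_⟩
    · refine le_trans ?_ h2.ge
      rw [le_div_iff₀ hk0]; linarith
    · refine h2.le.trans ?_
      rw [div_le_iff₀ hk0]; linarith
  · change ∑ _j : Fin k, 1 = k
    simp

/-- The states of the weight computation reached by accurate runs. -/
def accurateStates (c : ℝ) (A : Matrix (Fin n) (Fin d) ℝ) (p : ℝ) (k : ℕ) :
    Set (LewisState n) :=
  {st | ∃ W, IsAccurateRun A p k W ∧ st.current = W k ∧ st.total = ∑ j ∈ Finset.range k, W j ∧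
    st.solves = k * sketchSize c n}

theorem lewisLoop_accurate {c : ℝ} (hc : 0 < c) (hn : 2 ≤ n) (A : Matrix (Fin n) (Fin d) ℝ)
    (p : ℝ) (k : ℕ) :
    ENNReal.ofReal (1 - 2 * (n : ℝ) ^ (1 - c / 8)) ^ k ≤
      (lewisLoop c A p k).toOuterMeasure (accurateStates c A p k) := by
  induction k with
  | zero =>
    rw [lewisLoop, PMF.toOuterMeasure_pure_apply, if_pos, pow_zero]
    exact ⟨fun _ _ => (d : ℝ) / n, ⟨rfl, by simp, by simp⟩, rfl, by simp, by simp⟩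
  | succ k ih =>
    rw [lewisLoop, pow_succ]
    refine (mul_le_mul_left ih _).trans (mul_le_toOuterMeasure_bind _ _ ?_)
    rintro st ⟨W, hW, h1, h2, h3⟩
    rw [PMF.toOuterMeasure_map_apply]
    refine (approxLev_accurate hc hn A _).trans (MeasureTheory.OuterMeasure.mono _ ?_)
    rintro new ⟨h4, h5⟩
    -- The new estimate extends the run at index k + 1 and leaves the earlier iterates alone.
    have hlt : ∀ j ≤ k, Function.update W (k + 1) new.1 j = W j := fun j hj =>
      Function.update_of_ne (by omega) _ _
    refine ⟨Function.update W (k + 1) new.1, ⟨?_, ?_, ?_⟩, ?_, ?_, ?_⟩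
    · rw [hlt 0 (Nat.zero_le k), hW.zero]
    · intro j hj i
      rw [hlt j (by omega)]
      rcases Nat.lt_succ_iff_lt_or_eq.1 hj with hj' | rfl
      · rw [hlt (j + 1) (by omega)]; exact hW.lower j hj' i
      · rw [Function.update_self, ← h1]; exact (h4 i).1
    · intro j hj i
      rw [hlt j (by omega)]
      rcases Nat.lt_succ_iff_lt_or_eq.1 hj with hj' | rfl
      · rw [hlt (j + 1) (by omega)]; exact hW.upper j hj' i
      · rw [Function.update_self, ← h1]; exact (h4 i).2
    · rw [Function.update_self]
    · simp only
      rw [Finset.sum_range_succ, hlt k le_rfl, h2, h1]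
      congr 1
      exact Finset.sum_congr rfl fun j hj => (hlt j (Finset.mem_range.1 hj).le).symm
    · simp only
      rw [h3, h5]; ring

/-- Bernoulli over the T ≤ 11n rounds. With c = 8(C+7) a round fails with probability at most 2
n^{-C-6}, and 22/n⁵ ≤ 1. -/
theorem one_sub_rpow_le_pow {C : ℝ} (hC : 0 < C) (hn : 2 ≤ n) :
    ENNReal.ofReal (1 - (n : ℝ) ^ (-C)) ≤
      ENNReal.ofReal (1 - 2 * (n : ℝ) ^ (1 - 8 * (C + 7) / 8)) ^ ⌈10 * Real.log n⌉₊ := by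
  have hn2 : (2 : ℝ) ≤ n := by exact_mod_cast hn
  have hn0 : (0 : ℝ) < n := by linarith
  set T := ⌈10 * Real.log n⌉₊ with hT
  have hlog : 0 ≤ Real.log n := Real.log_nonneg (by linarith)
  have hTle : (T : ℝ) ≤ 11 * n := by
    have h1 := Nat.ceil_lt_add_one (show 0 ≤ 10 * Real.log n by positivity)
    have h2 := Real.log_le_sub_one_of_pos hn0
    linarith
  have e1 : (n : ℝ) ^ (1 - 8 * (C + 7) / 8) = (n : ℝ) ^ (-C) / n ^ 6 := by
    rw [show 1 - 8 * (C + 7) / 8 = -C - (6 : ℕ) by push_cast; ring, Real.rpow_sub hn0,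
      Real.rpow_natCast]
  set X := (n : ℝ) ^ (-C) with hX
  have hX0 : 0 < X := by positivity
  have hX1 : X ≤ 1 := Real.rpow_le_one_of_one_le_of_nonpos (by linarith) (by linarith)
  have h32 : (32 : ℝ) ≤ n ^ 5 := by
    calc (32 : ℝ) = 2 ^ 5 := by norm_num
      _ ≤ _ := by gcongr
  set δ := 2 * (X / (n : ℝ) ^ 6) with hδ
  have hδ0 : 0 ≤ δ := by positivity
  have hTδ : T * δ ≤ X := by
    calc T * δ ≤ 11 * n * (2 * (X / (n : ℝ) ^ 6)) := by rw [hδ]; gcongr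
      _ = 22 / n ^ 5 * X := by field_simp; norm_num
      _ ≤ 1 * X := by
          gcongr
          rw [div_le_one (by positivity)]; linarith
      _ = X := one_mul X
  have hδ1 : δ ≤ 1 := by
    have h64 : (2 : ℝ) ≤ n ^ 6 := by
      calc (2 : ℝ) ≤ 2 ^ 6 := by norm_num
        _ ≤ _ := by gcongr
    rw [hδ, ← mul_div_assoc, div_le_one (by positivity)]
    linarith
  rw [e1, ← ENNReal.ofReal_pow (by linarith)]
  apply ENNReal.ofReal_le_ofReal
  have h1 := one_add_mul_le_pow (show (-2 : ℝ) ≤ -δ by linarith) T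
  rw [← sub_eq_add_neg] at h1
  linarith

theorem weight_solves_le {c : ℝ} (hc : 0 < c) (hn : 2 ≤ n) :
    ((⌈10 * Real.log n⌉₊ * sketchSize c n : ℕ) : ℝ) ≤ 12 * (100 * c + 2) * Real.log n ^ 2 := by
  have hlog : 0.69 ≤ Real.log n := by
    have h1 : Real.log 2 ≤ Real.log n := Real.log_le_log (by norm_num) (by exact_mod_cast hn)
    linarith [Real.log_two_gt_d9]
  have h1 : (⌈10 * Real.log n⌉₊ : ℝ) ≤ 12 * Real.log n := by
    have := Nat.ceil_lt_add_one (show 0 ≤ 10 * Real.log n by linarith)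
    linarith
  have h2 : (sketchSize c n : ℝ) ≤ (100 * c + 2) * Real.log n := by
    have := Nat.ceil_lt_add_one (show 0 ≤ c * (1 / 10 : ℝ)⁻¹ ^ 2 * Real.log n by positivity)
    norm_num at this
    unfold sketchSize
    norm_num
    linarith
  push_cast
  calc _ ≤ 12 * Real.log n * ((100 * c + 2) * Real.log n) := by gcongr
    _ = _ := by ring

end LpOracle

end

/-- `K` is absolute; `c` (the size of the leverage score sketches) and `L` depend only on the
exponent `C` in the failure probability `n^{-C}`. -/
theorem mainTheorem4 :
    ∃ K : ℝ, 0 < K ∧ ∀ C : ℝ, 0 < C → ∃ c : ℝ, 0 < c ∧ ∃ L : ℝ, 0 < L ∧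
      ∀ (p : ℝ), 2 ≤ p → ∀ (n d : ℕ) (A : Matrix (Fin n) (Fin d) ℝ) (g : Fin d → ℝ)
        (r : Fin n → ℝ), A.rank = d → LpOracle.IsScaledResidual A g r p →
        ENNReal.ofReal (1 - (n : ℝ) ^ (-C)) ≤
          (LpOracle.approxLargeWeights c A p).toOuterMeasure
            {W | ∃ (y : Fin d → ℝ) (N : ℕ), LpOracle.OracleReturns A g r p W.1 y N ∧
              LpOracle.IsApproxSolution A g r p ((K * p) ^ p) y ∧
              (N : ℝ) ≤ (K * p) ^ p * (d : ℝ) ^ ((p - 2) / (3 * p - 2)) ∧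
              (W.2 : ℝ) ≤ L * Real.log n ^ 2} := by
  refine ⟨1000, by norm_num, fun C hC => ⟨8 * (C + 7), by positivity,
    12 * (100 * (8 * (C + 7)) + 2), by positivity, fun p hp n d A g r hrank hres => ?_⟩⟩
  have hA := LpOracle.injective_mulVec_of_rank_eq hrank
  have hd : 0 < d := by
    rcases Nat.eq_zero_or_pos d with rfl | h
    · obtain ⟨-, x, hx, -⟩ := hres
      simp [dotProduct] at hx
    · exact h
  have hdn : d ≤ n := by
    rw [← hrank]; exact A.rank_le_height
  -- For n = 1 the required probability is 1 - 1 = 0, and log n gives no rounds at all.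
  rcases (show 1 ≤ n by omega).eq_or_lt with rfl | hn
  · simp
  have hn : 2 ≤ n := hn
  set c := 8 * (C + 7) with hc
  have hc0 : 0 < c := by positivity
  refine (LpOracle.one_sub_rpow_le_pow hC hn).trans ?_
  refine (LpOracle.lewisLoop_accurate hc0 hn A p _).trans ?_
  rw [LpOracle.approxLargeWeights, PMF.toOuterMeasure_map_apply]
  refine MeasureTheory.OuterMeasure.mono _ ?_
  rintro st ⟨W, hW, -, h2, h3⟩
  have hlewis := hW.isLewisOverestimate hA hp hn hd (Nat.le_ceil _)
  rw [← h2] at hlewis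
  obtain ⟨y, N, h4, h5, h6⟩ :=
    LpOracle.OracleInput.exists_oracleReturns ⟨hp, hA, hres, hlewis⟩
  refine ⟨y, N, h4, h5, h6, ?_⟩
  change ((st.solves : ℕ) : ℝ) ≤ _
  rw [h3]
  exact LpOracle.weight_solves_le hc0 hn
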